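/- Let $n,m\ge 1$, $p=\min(n,m)$, and let $G_{n,m}$ be the Grassmannian of oriented $n$-dimensional subspaces of $\mathbb R^{n+m}$. Fix $P_0\in G_{n,m}$ and an orthonormal basis $\varepsilon_1,\dots,\varepsilon_{n+m}$ of $\mathbb R^{n+m}$ such that $P_0$ is spanned by $\varepsilon_1\wedge\dots\wedge\varepsilon_n$. For $P\in G_{n,m}$ with positively oriented orthonormal basis $e_1,\dots,e_n$ and any positively oriented orthonormal basis $\varepsilon'_1,\dots,\varepsilon'_n$ of $P_0$, let $W=(\langle e_i,\varepsilon'_j\rangle)$ and $w(P)=\det W$. The Jordan angles of $P$ and $P_0$ are $\theta_\alpha=\arccos\mu_\alpha\in[0,\pi/2]$, $1\le\alpha\le p$, where $\mu_1^2,\dots,\mu_p^2$ ($\mu_\alpha\ge 0$) are the $p$ smallest eigenvalues of $W^TW$, counted with multiplicity (the remaining $n-p$ eigenvalues are $1$). Let $\mathbb U=\{P\in G_{n,m}: w(P)>0\}$. Every $P\in\mathbb U$ has a unique coordinate matrix $Z=(z_{i\alpha})\in\mathbb R^{n\times m}$ such that $P$ is the oriented span of the vectors $f_i=\varepsilon_i+\sum_\alpha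 z_{i\alpha}\varepsilon_{n+\alpha}$, $1\le i\le n$. Equip $\mathbb U$ with the canonical metric of $G_{n,m}$, which in these coordinates is $$g=\operatorname{tr}\big((I_n+ZZ^T)^{-1}\,dZ\,(I_m+Z^TZ)^{-1}\,dZ^T\big),$$ and let $\mathrm{Hess}$ be the Hessian with respect to its Levi-Civita connection. Let $$B_{JX}(P_0)=\{P\in\mathbb U:\ \theta_\alpha+\theta_\beta<\tfrac{\pi}{2}\ \text{for all }\alpha\ne\beta\},\qquad v=\frac1w\ \text{ on }\mathbb U.$$ Then: 1. $v$ is a smooth function on $\mathbb U$, and $v=\prod_{\alpha=1}^{p}\sec\theta_\alpha$ on $\mathbb U$. 2. $v$ is convex on $B_{JX}(P_0)$: it is a convex function along every geodesic contained in $B_{JX}(P_0)$, and moreover $\mathrm{Hess}(v)$ is positive definite at every point of $B_{JX}(P_0)$. 3. At every point of $\{P\in\mathbb U: v(P)\le 2\}$, $$\mathrm{Hess}(v)\ \ge\ v(2-v)\,g+\Big(\frac{v-1}{p\,v\,(v^{2/p}-1)}+\frac{p+1}{p\,v}\Big)\,dv\otimes dv$$ as quadratic forms. (At the point $P_0$,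 where $v=1$ and the first fraction reads $0/0$, one has $dv=0$ and the last term is zero.) -/

import Mathlib

noncomputable section

namespace Grass

open scoped InnerProductSpace Matrix ContDiff

/-- The Euclidean space `ℝ^{n+m}`. -/
abbrev Ambient (n m : ℕ) : Type := EuclideanSpace ℝ (Fin (n + m))

/-- A point of the oriented Grassmannian: an `n`-dimensional linear subspace of `ℝ^{n+m}`
together with an orientation. -/
structure OrientedPlane (n m : ℕ) where
  carrier : Submodule ℝ (Ambient n m)
  finrank_carrier : Module.finrank ℝ carrier = n
  orientation : Orientation ℝ carrier (Fin n)

variable {n m : ℕ}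

/-- The oriented `n`-plane represented by the `n`-vector `f₁ ∧ ⋯ ∧ fₙ`. -/
def orientedSpan (f : Fin n → Ambient n m) (hf : LinearIndependent ℝ f) : OrientedPlane n m where
  carrier := Submodule.span ℝ (Set.range f)
  finrank_carrier := by rw [finrank_span_eq_card hf, Fintype.card_fin]
  orientation := (Module.Basis.span hf).orientation

/-- A positively oriented orthonormal basis `e₁, …, eₙ` of an oriented plane. The quantities below
do not depend on which one is taken. -/
def OrientedPlane.frame [NeZero n] (P : OrientedPlane n m) :
    OrthonormalBasis (Fin n) ℝ P.carrier :=
  P.orientation.finOrthonormalBasis (Nat.pos_of_ne_zero (NeZero.ne n)) P.finrank_carrier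

/-- The matrix `W = (⟨e_i, ε_j⟩)` for positive orthonormal bases `e` of `P` and `ε` of `P₀`. -/
def gramMatrix [NeZero n] (P₀ P : OrientedPlane n m) : Matrix (Fin n) (Fin n) ℝ :=
  Matrix.of fun i j => ⟪(P.frame i : Ambient n m), (P₀.frame j : Ambient n m)⟫_ℝ

/-- `w(P) = ⟨e₁ ∧ ⋯ ∧ eₙ, ε₁ ∧ ⋯ ∧ εₙ⟩ = det W`. -/
def w [NeZero n] (P₀ P : OrientedPlane n m) : ℝ := (gramMatrix P₀ P).det

/-- The domain `U = {P : w(P) > 0}`. -/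
def domainU [NeZero n] (P₀ : OrientedPlane n m) : Set (OrientedPlane n m) := {P | 0 < w P₀ P}

/-- The function `v = 1 / w`, to be used on `U` only. -/
def v [NeZero n] (P₀ P : OrientedPlane n m) : ℝ := (w P₀ P)⁻¹

/-- The `p = min n m` Jordan angles `θ = arccos μ` between `P` and `P₀`, where the `μ²` are the `p`
smallest eigenvalues of the `n × n` matrix `Wᵀ W` with multiplicity (the other `n - p` eigenvalues
are always `1`). The sequence `eigenvalues₀` is in decreasing order. -/
def jordanAngle [NeZero n] (P₀ P : OrientedPlane n m) (k : Fin (min n m)) : ℝ :=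
  Real.arccos √((Matrix.isHermitian_conjTranspose_mul_self (gramMatrix P₀ P)).eigenvalues₀
    ⟨n - min n m + k, by rw [Fintype.card_fin]; have := k.isLt; omega⟩)

/-- The set `B_{JX}(P₀) ⊆ U`: the sum of any two Jordan angles (with different indices) between
`P` and `P₀` is less than `π / 2`. -/
def ballJX [NeZero n] (P₀ : OrientedPlane n m) : Set (OrientedPlane n m) :=
  {P | P ∈ domainU P₀ ∧ ∀ α β : Fin (min n m), α ≠ β →
    jordanAngle P₀ P α + jordanAngle P₀ P β < Real.pi / 2}

section chart

/-- The vectors `f_i = ε_i + ∑ α, z_{iα} ε_{n+α}`. -/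
def graphVec (ε : OrthonormalBasis (Fin n ⊕ Fin m) ℝ (Ambient n m)) (Z : Matrix (Fin n) (Fin m) ℝ)
    (i : Fin n) : Ambient n m :=
  ε (Sum.inl i) + ∑ α, Z i α • ε (Sum.inr α)

theorem linearIndependent_inl (ε : OrthonormalBasis (Fin n ⊕ Fin m) ℝ (Ambient n m)) :
    LinearIndependent ℝ (fun i : Fin n => ε (Sum.inl i)) :=
  ε.orthonormal.linearIndependent.comp _ Sum.inl_injective

theorem linearIndependent_graphVec (ε : OrthonormalBasis (Fin n ⊕ Fin m) ℝ (Ambient n m))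
    (Z : Matrix (Fin n) (Fin m) ℝ) : LinearIndependent ℝ (graphVec ε Z) := by
  rw [Fintype.linearIndependent_iff]
  intro c hc j
  have h := congrArg (fun x => ⟪ε (Sum.inl j), x⟫_ℝ) hc
  simpa [graphVec, inner_sum, inner_add_right, inner_smul_right,
    orthonormal_iff_ite.mp ε.orthonormal] using h

/-- The inverse of the coordinate chart: the oriented plane spanned by `f₁, …, fₙ`. -/
def graphPlane (ε : OrthonormalBasis (Fin n ⊕ Fin m) ℝ (Ambient n m))
    (Z : Matrix (Fin n) (Fin m) ℝ) : OrientedPlane n m :=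
  orientedSpan (graphVec ε Z) (linearIndependent_graphVec ε Z)

/-- The coordinate matrix of `P ∈ U`: if `e_i = ∑ j, a_{ij} ε_j + ∑ α, b_{iα} ε_{n+α}`, then
`A⁻¹ e` is the basis `f_i = ε_i + ∑ α, z_{iα} ε_{n+α}` of `P` with `Z = A⁻¹ B`. -/
def coord [NeZero n] (ε : OrthonormalBasis (Fin n ⊕ Fin m) ℝ (Ambient n m))
    (P : OrientedPlane n m) : Matrix (Fin n) (Fin m) ℝ :=
  (Matrix.of fun i j : Fin n => ⟪(P.frame i : Ambient n m), ε (Sum.inl j)⟫_ℝ)⁻¹ *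
    Matrix.of fun (i : Fin n) (α : Fin m) => ⟪(P.frame i : Ambient n m), ε (Sum.inr α)⟫_ℝ

end chart

section coordinates

/-- The canonical metric in the coordinates `Z`:
`⟨X, Y⟩_Z = tr ((I + Z Zᵀ)⁻¹ X (I + Zᵀ Z)⁻¹ Yᵀ)`. -/
def metric (Z X Y : Matrix (Fin n) (Fin m) ℝ) : ℝ :=
  ((1 + Z * Zᵀ)⁻¹ * X * (1 + Zᵀ * Z)⁻¹ * Yᵀ).trace

/-- The coordinate vector `E_{iα}`. -/
def coordVec (a : Fin n × Fin m) : Matrix (Fin n) (Fin m) ℝ := Matrix.single a.1 a.2 1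

/-- The partial derivative `∂F / ∂z_{iα}` of a function of the coordinates. -/
def partialDeriv (a : Fin n × Fin m) (F : Matrix (Fin n) (Fin m) ℝ → ℝ)
    (Z : Matrix (Fin n) (Fin m) ℝ) : ℝ :=
  lineDeriv ℝ F Z (coordVec a)

/-- The matrix `g_{ab}` of the metric in the coordinate frame. -/
def metricMatrix (Z : Matrix (Fin n) (Fin m) ℝ) : Matrix (Fin n × Fin m) (Fin n × Fin m) ℝ :=
  Matrix.of fun a b => metric Z (coordVec a) (coordVec b)

/-- The Christoffel symbols `Γ_{ab}^c` of the Levi-Civita connection of the metric. -/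
def christoffel (Z : Matrix (Fin n) (Fin m) ℝ) (a b c : Fin n × Fin m) : ℝ :=
  (1 / 2) * ∑ d, (metricMatrix Z)⁻¹ c d *
    (- partialDeriv d (fun Z' => metricMatrix Z' a b) Z
      + partialDeriv a (fun Z' => metricMatrix Z' b d) Z
      + partialDeriv b (fun Z' => metricMatrix Z' d a) Z)

/-- The components `∂_a ∂_b F - Γ_{ab}^c ∂_c F` of the Riemannian Hessian. -/
def hessComponent (F : Matrix (Fin n) (Fin m) ℝ → ℝ) (Z : Matrix (Fin n) (Fin m) ℝ)
    (a b : Fin n × Fin m) : ℝ :=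
  partialDeriv a (partialDeriv b F) Z - ∑ c, christoffel Z a b c * partialDeriv c F Z

end coordinates

section intrinsic

variable [NeZero n] (ε : OrthonormalBasis (Fin n ⊕ Fin m) ℝ (Ambient n m))

/-- The metric at `P ∈ U`; tangent vectors are given by their components in the chart. -/
def metricAt (P : OrientedPlane n m) (X Y : Matrix (Fin n) (Fin m) ℝ) : ℝ :=
  metric (coord ε P) X Y

/-- The differential at `P ∈ U` of a function on the Grassmannian. -/
def differential (f : OrientedPlane n m → ℝ) (P : OrientedPlane n m)
    (X : Matrix (Fin n) (Fin m) ℝ) : ℝ :=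
  ∑ a : Fin n × Fin m,
    X a.1 a.2 * partialDeriv a (fun Z => f (graphPlane ε Z)) (coord ε P)

/-- The Riemannian Hessian at `P ∈ U` of a function on the Grassmannian. -/
def hess (f : OrientedPlane n m → ℝ) (P : OrientedPlane n m)
    (X Y : Matrix (Fin n) (Fin m) ℝ) : ℝ :=
  ∑ a : Fin n × Fin m, ∑ b : Fin n × Fin m,
    X a.1 a.2 * Y b.1 b.2 * hessComponent (fun Z => f (graphPlane ε Z)) (coord ε P) a b

/-- `γ` is, on the open set `s` of times, a geodesic of `U`. -/
def IsGeodesicOn (P₀ : OrientedPlane n m) (γ : ℝ → OrientedPlane n m) (s : Set ℝ) : Prop :=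
  (∀ t ∈ s, γ t ∈ domainU P₀) ∧
  (∀ i α, ContDiffOn ℝ 2 (fun t => coord ε (γ t) i α) s) ∧
  ∀ t ∈ s, ∀ c : Fin n × Fin m,
    deriv (deriv fun τ => coord ε (γ τ) c.1 c.2) t +
      ∑ a : Fin n × Fin m, ∑ b : Fin n × Fin m, christoffel (coord ε (γ t)) a b c *
        deriv (fun τ => coord ε (γ τ) a.1 a.2) t * deriv (fun τ => coord ε (γ τ) b.1 b.2) t = 0

/-- `f` is convex on the subset `S` of `U`: it is convex along every geodesic contained in `S`. -/
def GeodesicallyConvexOn (P₀ : OrientedPlane n m) (f : OrientedPlane n m → ℝ)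
    (S : Set (OrientedPlane n m)) : Prop :=
  ∀ (s : Set ℝ) (γ : ℝ → OrientedPlane n m), IsOpen s → Convex ℝ s →
    IsGeodesicOn ε P₀ γ s → (∀ t ∈ s, γ t ∈ S) → ConvexOn ℝ s (fun t => f (γ t))

end intrinsic

end Grass

end

noncomputable section

namespace Grass

open scoped InnerProductSpace Matrix ContDiff Kronecker

variable {n m : ℕ}

/-! Write `A = (1 + Z Zᵀ)⁻¹`. If `e = C ε + B ε'` is the frame of `P`, then `Z = C⁻¹ B` and Parseval
gives `C (1 + Z Zᵀ) Cᵀ = 1`. Hence `v = √det (1 + Z Zᵀ)`, and `Cᵀ C = A` has the eigenvalues `a i`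
of `Wᵀ W`, the squared cosines of the Jordan angles, padded by ones.

The Koszul formula gives the Christoffel tensor `Γ(X, Y) = -(X Zᵀ A Y + Y Zᵀ A X)`
(`christoffel_eq`), and differentiating `v` twice gives `Hess v (X, Y) = v (g(X, Y) + tr(A X Zᵀ)
tr(A Y Zᵀ) + tr(A X Zᵀ A Y Zᵀ))` (`hessComponent_vCoord`), while `dv(X) = v tr(A X Zᵀ)`.

Diagonalise `A` and put `l i = √(1 / a i - 1)`, the tangent of the angle. In rescaled components `η`
(`exists_rescaled_components`) the form splits into blocks, one for each pair `(i, k), (k, i)`,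
governed by `η i k ^ 2 + η k i ^ 2 + 2 l i l k η i k η k i`. Off the diagonal this is definite when
`l i * l k < 1`, that is, when the two angles sum to less than `π / 2`; this is convexity.

For the lower bound, remove `(2 - v) g` and keep `(v - 1) g`. Since `l i * l k ≤ v - 1` for `i ≠ k`,
off-diagonal blocks are nonnegative and can be dropped. On the diagonal, weighted Cauchy–Schwarz
compares with `dv ^ 2`, and Jensen's inequality under the constraint `∏ (1 + l i ^ 2) = v ^ 2`
produces the constant (`sq_sum_le_of_prod_eq`). -/

theorem inner_graphVec_inl (ε : OrthonormalBasis (Fin n ⊕ Fin m) ℝ (Ambient n m))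
    (Z : Matrix (Fin n) (Fin m) ℝ) (i j : Fin n) :
    ⟪graphVec ε Z i, ε (Sum.inl j)⟫_ℝ = (1 : Matrix (Fin n) (Fin n) ℝ) i j := by
  simp [graphVec, sum_inner, inner_add_left, inner_smul_left,
    orthonormal_iff_ite.mp ε.orthonormal, Matrix.one_apply]

theorem inner_graphVec_inr (ε : OrthonormalBasis (Fin n ⊕ Fin m) ℝ (Ambient n m))
    (Z : Matrix (Fin n) (Fin m) ℝ) (i : Fin n) (α : Fin m) :
    ⟪graphVec ε Z i, ε (Sum.inr α)⟫_ℝ = Z i α := by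
  simp [graphVec, sum_inner, inner_add_left, inner_smul_left,
    orthonormal_iff_ite.mp ε.orthonormal]

/-! ### Orthonormal frames of oriented planes and their components -/

section frames

variable [NeZero n]

/-- Both bases induce the same orientation. The frame is an arbitrary choice; this comparison and
orthonormality are all that is used about it. -/
theorem exists_det_pos_eq_sum_frame (f : Fin n → Ambient n m) (hf : LinearIndependent ℝ f) :
    ∃ c : Matrix (Fin n) (Fin n) ℝ, 0 < c.det ∧
      ∀ i, f i = ∑ j, c i j • ((orientedSpan f hf).frame j : Ambient n m) := by
  set P := orientedSpan f hf with hP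
  have h1 : P.frame.toBasis.orientation = P.orientation :=
    P.orientation.finOrthonormalBasis_orientation _ _
  have h2 : (Module.Basis.span hf).orientation = P.orientation := rfl
  have h3 : 0 < P.frame.toBasis.det (Module.Basis.span hf) :=
    (P.frame.toBasis.orientation_eq_iff_det_pos (Module.Basis.span hf)).1 (h1.trans h2.symm)
  refine ⟨(P.frame.toBasis.toMatrix (Module.Basis.span hf))ᵀ, ?_, fun i => ?_⟩
  · rw [Matrix.det_transpose]
    exact h3
  · have h : ((Module.Basis.span hf i : P.carrier) : Ambient n m) = _ := congrArg Subtype.val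
      (P.frame.toBasis.sum_toMatrix_smul_self (Module.Basis.span hf) i).symm
    rw [Submodule.coe_sum] at h
    have h0 : f i = ((Module.Basis.span hf i : P.carrier) : Ambient n m) :=
      (congrArg Subtype.val (Module.Basis.span_apply hf i)).symm
    refine (h0.trans h).trans ?_
    refine Finset.sum_congr rfl fun j _ => ?_
    simp

theorem inner_frame (P : OrientedPlane n m) (i j : Fin n) :
    ⟪(P.frame i : Ambient n m), (P.frame j : Ambient n m)⟫_ℝ = if i = j then 1 else 0 := by
  rw [← Submodule.coe_inner]
  exact orthonormal_iff_ite.mp P.frame.orthonormal i j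

/-- The components `⟨e_i, ε_j⟩`, `j ≤ n`, of the frame of `P`. -/
def inlMatrix (ε : OrthonormalBasis (Fin n ⊕ Fin m) ℝ (Ambient n m)) (P : OrientedPlane n m) :
    Matrix (Fin n) (Fin n) ℝ :=
  Matrix.of fun i j => ⟪(P.frame i : Ambient n m), ε (Sum.inl j)⟫_ℝ

/-- The components `⟨e_i, ε_{n+α}⟩` of the frame of `P`. -/
def inrMatrix (ε : OrthonormalBasis (Fin n ⊕ Fin m) ℝ (Ambient n m)) (P : OrientedPlane n m) :
    Matrix (Fin n) (Fin m) ℝ :=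
  Matrix.of fun i α => ⟪(P.frame i : Ambient n m), ε (Sum.inr α)⟫_ℝ

variable (ε : OrthonormalBasis (Fin n ⊕ Fin m) ℝ (Ambient n m))

theorem coord_eq (P : OrientedPlane n m) : coord ε P = (inlMatrix ε P)⁻¹ * inrMatrix ε P := rfl

/-- Parseval's identity in the basis `ε` for the inner products of the orthonormal frame. -/
theorem inlMatrix_mul_transpose_add (P : OrientedPlane n m) :
    inlMatrix ε P * (inlMatrix ε P)ᵀ + inrMatrix ε P * (inrMatrix ε P)ᵀ = 1 := by
  ext i j
  have h := ε.sum_inner_mul_inner (P.frame i : Ambient n m) (P.frame j : Ambient n m)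
  rw [inner_frame, Fintype.sum_sum_type] at h
  simpa [Matrix.mul_apply, inlMatrix, inrMatrix, Matrix.one_apply, real_inner_comm] using h

/-- The matrix of `f` in the frame of its oriented span, multiplied by the components of that
frame, gives the components of `f`. -/
theorem mul_inlMatrix {P : OrientedPlane n m} {f : Fin n → Ambient n m}
    {c : Matrix (Fin n) (Fin n) ℝ} (hc : ∀ i, f i = ∑ j, c i j • (P.frame j : Ambient n m)) :
    c * inlMatrix ε P = Matrix.of fun i j => ⟪f i, ε (Sum.inl j)⟫_ℝ := by
  ext i j
  simp [hc i, Matrix.mul_apply, inlMatrix, sum_inner, inner_smul_left]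

theorem mul_inrMatrix {P : OrientedPlane n m} {f : Fin n → Ambient n m}
    {c : Matrix (Fin n) (Fin n) ℝ} (hc : ∀ i, f i = ∑ j, c i j • (P.frame j : Ambient n m)) :
    c * inrMatrix ε P = Matrix.of fun i j => ⟪f i, ε (Sum.inr j)⟫_ℝ := by
  ext i j
  simp [hc i, Matrix.mul_apply, inrMatrix, sum_inner, inner_smul_left]

theorem det_inlMatrix_graphPlane_pos (Z : Matrix (Fin n) (Fin m) ℝ) :
    0 < (inlMatrix ε (graphPlane ε Z)).det := by
  obtain ⟨c, hc, h⟩ := exists_det_pos_eq_sum_frame _ (linearIndependent_graphVec ε Z)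
  have h1 : c * inlMatrix ε (graphPlane ε Z) = 1 := by
    rw [mul_inlMatrix ε (P := graphPlane ε Z) h]
    ext i j
    exact inner_graphVec_inl ε Z i j
  have h2 := congrArg Matrix.det h1
  rw [Matrix.det_mul, Matrix.det_one] at h2
  exact (pos_iff_pos_of_mul_pos (h2 ▸ one_pos)).1 hc

theorem coord_graphPlane (Z : Matrix (Fin n) (Fin m) ℝ) : coord ε (graphPlane ε Z) = Z := by
  obtain ⟨c, hc, h⟩ := exists_det_pos_eq_sum_frame _ (linearIndependent_graphVec ε Z)
  have h1 : c * inlMatrix ε (graphPlane ε Z) = 1 := by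
    rw [mul_inlMatrix ε (P := graphPlane ε Z) h]
    ext i j
    exact inner_graphVec_inl ε Z i j
  rw [coord_eq, Matrix.inv_eq_left_inv h1, mul_inrMatrix ε (P := graphPlane ε Z) h]
  ext i j
  exact inner_graphVec_inr ε Z i j

/-- Passing from the frame of `P₀` to `ε₁, …, εₙ` is a rotation. -/
theorem exists_rotation {P₀ : OrientedPlane n m}
    (hε : P₀ = orientedSpan (fun i => ε (Sum.inl i)) (linearIndependent_inl ε)) :
    ∃ c : Matrix (Fin n) (Fin n) ℝ, c * cᵀ = 1 ∧ c.det = 1 ∧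
      ∀ P, inlMatrix ε P = gramMatrix P₀ P * cᵀ := by
  obtain ⟨c, hc, h⟩ := exists_det_pos_eq_sum_frame _ (linearIndependent_inl ε)
  rw [← hε] at h
  have h1 : c * cᵀ = 1 := by
    ext i j
    have h2 := orthonormal_iff_ite.mp ε.orthonormal (Sum.inl i) (Sum.inl j)
    rw [h i, h j] at h2
    simpa [sum_inner, inner_sum, inner_smul_left, inner_smul_right, inner_frame,
      Matrix.mul_apply, Matrix.one_apply, mul_comm] using h2
  refine ⟨c, h1, ?_, fun P => ?_⟩
  · have h2 := congrArg Matrix.det h1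
    rw [Matrix.det_mul, Matrix.det_transpose, Matrix.det_one] at h2
    nlinarith
  · ext i j
    simp [inlMatrix, h j, Matrix.mul_apply, gramMatrix, inner_sum, inner_smul_right, mul_comm]

theorem det_inlMatrix {P₀ : OrientedPlane n m}
    (hε : P₀ = orientedSpan (fun i => ε (Sum.inl i)) (linearIndependent_inl ε))
    (P : OrientedPlane n m) : (inlMatrix ε P).det = w P₀ P := by
  obtain ⟨c, -, hc, h⟩ := exists_rotation ε hε
  rw [h, Matrix.det_mul, Matrix.det_transpose, hc, mul_one, w]

end frames

theorem posDef_one_add (Z : Matrix (Fin n) (Fin m) ℝ) : (1 + Z * Zᵀ).PosDef := by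
  have h := Matrix.posSemidef_self_mul_conjTranspose Z
  rw [Matrix.conjTranspose_eq_transpose_of_trivial] at h
  exact Matrix.PosDef.one.add_posSemidef h

theorem det_one_add_pos (Z : Matrix (Fin n) (Fin m) ℝ) : 0 < (1 + Z * Zᵀ).det :=
  (posDef_one_add Z).det_pos

/-! ### The function `v` and the matrix `Wᵀ W` in the chart -/

section coordinates

variable [NeZero n] (ε : OrthonormalBasis (Fin n ⊕ Fin m) ℝ (Ambient n m))

/-- Parseval's identity with the second block written as the first block times `Z`. Its determinant
yields `v`, and its rearrangement yields the link with `Wᵀ W`. -/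
theorem inlMatrix_mul_one_add_mul {P : OrientedPlane n m} (hP : 0 < (inlMatrix ε P).det) :
    inlMatrix ε P * (1 + coord ε P * (coord ε P)ᵀ) * (inlMatrix ε P)ᵀ = 1 := by
  have hu : IsUnit (inlMatrix ε P).det := hP.ne'.isUnit
  have h1 : inlMatrix ε P * coord ε P = inrMatrix ε P := by
    rw [coord_eq, Matrix.mul_nonsing_inv_cancel_left _ _ hu]
  calc _ = inlMatrix ε P * (inlMatrix ε P)ᵀ
        + (inlMatrix ε P * coord ε P) * (inlMatrix ε P * coord ε P)ᵀ := by
        rw [Matrix.transpose_mul]; simp only [Matrix.mul_add, Matrix.add_mul, Matrix.mul_assoc,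
          Matrix.mul_one]
    _ = 1 := by rw [h1, inlMatrix_mul_transpose_add]

theorem inlMatrix_transpose_mul {P : OrientedPlane n m} (hP : 0 < (inlMatrix ε P).det) :
    (inlMatrix ε P)ᵀ * inlMatrix ε P = (1 + coord ε P * (coord ε P)ᵀ)⁻¹ := by
  have h := inlMatrix_mul_one_add_mul ε hP
  rw [Matrix.mul_assoc, mul_eq_one_comm, Matrix.mul_assoc] at h
  exact (Matrix.inv_eq_right_inv h).symm

/-- The function `v` in coordinates. -/
def vCoord (Z : Matrix (Fin n) (Fin m) ℝ) : ℝ := √(1 + Z * Zᵀ).det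

theorem inv_det_inlMatrix {P : OrientedPlane n m} (hP : 0 < (inlMatrix ε P).det) :
    (inlMatrix ε P).det⁻¹ = vCoord (coord ε P) := by
  have h := congrArg Matrix.det (inlMatrix_mul_one_add_mul ε hP)
  rw [Matrix.det_mul, Matrix.det_mul, Matrix.det_transpose, Matrix.det_one] at h
  rw [vCoord, eq_comm, Real.sqrt_eq_iff_mul_self_eq_of_pos (inv_pos.2 hP)]
  field_simp
  linarith

variable {ε} {P₀ : OrientedPlane n m}
theorem v_eq_vCoord
    (hε : P₀ = orientedSpan (fun i => ε (Sum.inl i)) (linearIndependent_inl ε))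
    {P : OrientedPlane n m} (hP : P ∈ domainU P₀) :
    v P₀ P = vCoord (coord ε P) := by
  rw [← inv_det_inlMatrix, det_inlMatrix ε hε, v]
  rw [det_inlMatrix ε hε]
  exact hP

theorem v_graphPlane
    (hε : P₀ = orientedSpan (fun i => ε (Sum.inl i)) (linearIndependent_inl ε))
    (Z : Matrix (Fin n) (Fin m) ℝ) : v P₀ (graphPlane ε Z) = vCoord Z := by
  rw [v_eq_vCoord hε, coord_graphPlane]
  rw [domainU, Set.mem_ofPred_eq, ← det_inlMatrix ε hε]
  exact det_inlMatrix_graphPlane_pos ε Z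

/-- The inverse of `1 + Z Zᵀ` is diagonalised, by a rotation, to the eigenvalues of `Wᵀ W`. -/
theorem exists_diagonalization
    (hε : P₀ = orientedSpan (fun i => ε (Sum.inl i)) (linearIndependent_inl ε))
    {P : OrientedPlane n m} (hP : P ∈ domainU P₀) :
    ∃ Q : Matrix (Fin n) (Fin n) ℝ, Q * Qᵀ = 1 ∧
      (1 + coord ε P * (coord ε P)ᵀ)⁻¹ = Q * Matrix.diagonal
        (Matrix.isHermitian_conjTranspose_mul_self (gramMatrix P₀ P)).eigenvalues * Qᵀ := by
  obtain ⟨c, hc, hd, h⟩ := exists_rotation ε hε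
  set H := Matrix.isHermitian_conjTranspose_mul_self (gramMatrix P₀ P) with hH
  have hs : (gramMatrix P₀ P)ᵀ * gramMatrix P₀ P = (H.eigenvectorUnitary : Matrix _ _ ℝ) *
      Matrix.diagonal H.eigenvalues * (H.eigenvectorUnitary : Matrix _ _ ℝ)ᵀ := by
    have := H.spectral_theorem
    rw [Unitary.conjStarAlgAut_apply] at this
    exact this
  have hU : (H.eigenvectorUnitary : Matrix (Fin n) (Fin n) ℝ) *
      (H.eigenvectorUnitary : Matrix (Fin n) (Fin n) ℝ)ᵀ = 1 := by
    rw [← Matrix.conjTranspose_eq_transpose_of_trivial]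
    exact Unitary.coe_mul_star_self H.eigenvectorUnitary
  refine ⟨c * (H.eigenvectorUnitary : Matrix _ _ ℝ), ?_, ?_⟩
  · rw [Matrix.transpose_mul, Matrix.mul_assoc, ← Matrix.mul_assoc _ _ cᵀ, hU, Matrix.one_mul, hc]
  · rw [← inlMatrix_transpose_mul ε (by rw [det_inlMatrix ε hε]; exact hP), h P,
      Matrix.transpose_mul, Matrix.transpose_transpose, Matrix.mul_assoc,
      ← Matrix.mul_assoc _ _ cᵀ, hs]
    simp only [Matrix.transpose_mul, Matrix.mul_assoc]

end coordinates

/-! ### Differential calculus for curves of matrices -/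

section curves

variable {ι κ ν : Type*}

/-- Entrywise derivative of a curve of matrices. -/
def HasMatDerivAt (Z : ℝ → Matrix ι κ ℝ) (Z' : Matrix ι κ ℝ) (t : ℝ) : Prop :=
  ∀ i j, HasDerivAt (fun s => Z s i j) (Z' i j) t

variable {t : ℝ}

theorem hasMatDerivAt_const (C : Matrix ι κ ℝ) : HasMatDerivAt (fun _ => C) 0 t :=
  fun i j => hasDerivAt_const t (C i j)

theorem hasMatDerivAt_line (Z X : Matrix ι κ ℝ) : HasMatDerivAt (fun s => Z + s • X) X t :=
  fun i j => by simpa using ((hasDerivAt_id t).mul_const (X i j)).const_add (Z i j)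

namespace HasMatDerivAt

theorem add {Z Y : ℝ → Matrix ι κ ℝ} {Z' Y' : Matrix ι κ ℝ} (hZ : HasMatDerivAt Z Z' t)
    (hY : HasMatDerivAt Y Y' t) : HasMatDerivAt (fun s => Z s + Y s) (Z' + Y') t :=
  fun i j => (hZ i j).add (hY i j)

theorem transpose {Z : ℝ → Matrix ι κ ℝ} {Z' : Matrix ι κ ℝ} (hZ : HasMatDerivAt Z Z' t) :
    HasMatDerivAt (fun s => (Z s)ᵀ) Z'ᵀ t :=
  fun i j => hZ j i

theorem mul [Fintype κ] {Z : ℝ → Matrix ι κ ℝ} {Y : ℝ → Matrix κ ν ℝ} {Z' : Matrix ι κ ℝ}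
    {Y' : Matrix κ ν ℝ} (hZ : HasMatDerivAt Z Z' t) (hY : HasMatDerivAt Y Y' t) :
    HasMatDerivAt (fun s => Z s * Y s) (Z' * Y t + Z t * Y') t := by
  intro i j
  have h := HasDerivAt.fun_sum (u := Finset.univ) fun k _ => (hZ i k).mul (hY k j)
  simpa [Matrix.mul_apply, Finset.sum_add_distrib] using h

theorem trace [Fintype ι] {Z : ℝ → Matrix ι ι ℝ} {Z' : Matrix ι ι ℝ}
    (hZ : HasMatDerivAt Z Z' t) : HasDerivAt (fun s => (Z s).trace) Z'.trace t :=
  HasDerivAt.fun_sum fun i _ => hZ i i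

theorem unique {Z : ℝ → Matrix ι κ ℝ} {Z' Z'' : Matrix ι κ ℝ} (hZ : HasMatDerivAt Z Z' t)
    (hZ' : HasMatDerivAt Z Z'' t) : Z' = Z'' := by
  ext i j
  exact (hZ i j).unique (hZ' i j)

variable [Fintype ι] [DecidableEq ι]

theorem differentiableAt_det {N : ℝ → Matrix ι ι ℝ} {N' : Matrix ι ι ℝ}
    (hN : HasMatDerivAt N N' t) : DifferentiableAt ℝ (fun s => (N s).det) t := by
  simp only [Matrix.det_apply]
  refine DifferentiableAt.fun_sum fun σ _ => DifferentiableAt.const_smul ?_ _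
  exact DifferentiableAt.fun_finsetProd fun i _ => (hN _ _).differentiableAt

/-- Jacobi's formula. -/
theorem det {N : ℝ → Matrix ι ι ℝ} {N' : Matrix ι ι ℝ} (hN : HasMatDerivAt N N' t)
    (hu : IsUnit (N t).det) :
    HasDerivAt (fun s => (N s).det) ((N t).det * ((N t)⁻¹ * N').trace) t := by
  let D : (ι → ι → ℝ) → ℝ := fun M => (Matrix.of M).det
  have hD : Differentiable ℝ D := by
    intro M
    simp only [D, Matrix.det_apply]
    refine DifferentiableAt.fun_sum fun σ _ => DifferentiableAt.const_smul ?_ _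
    simp only [Matrix.of_apply]
    fun_prop
  have h1 : HasDerivAt (fun s => D (N s)) (fderiv ℝ D (N t) N') t := by
    have h : HasDerivAt (F := ι → ι → ℝ) N N' t :=
      hasDerivAt_pi.2 fun i => hasDerivAt_pi.2 fun j => hN i j
    exact HasFDerivAt.comp_hasDerivAt (F := ι → ι → ℝ) t (hD (N t)).hasFDerivAt h
  have h2 : HasDerivAt (fun s : ℝ => D (N t + s • N')) (fderiv ℝ D (N t) N') 0 := by
    have h := (hD (N t)).hasFDerivAt.hasLineDerivAt (N' : ι → ι → ℝ)
    exact h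
  -- On a line the determinant is `det N * det (1 + s N⁻¹ N')`, and the second factor is `1 + s tr
  -- (N⁻¹ N')` plus a multiple of `s ^ 2`.
  have h3 : HasDerivAt (fun s : ℝ => D (N t + s • N')) ((N t).det * ((N t)⁻¹ * N').trace) 0 := by
    have h4 : (fun s : ℝ => D (N t + s • N')) = fun s => (N t).det *
        (1 + ((N t)⁻¹ * N').trace * s + (Matrix.det (1 + (Polynomial.X : Polynomial ℝ) •
          ((N t)⁻¹ * N').map Polynomial.C)).divX.divX.eval s * s ^ 2) := by
      funext s
      rw [← Matrix.det_one_add_smul, ← Matrix.det_mul, Matrix.mul_add, Matrix.mul_one,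
        Matrix.mul_smul, Matrix.mul_nonsing_inv_cancel_left _ _ hu]
      rfl
    rw [h4]
    set q := (Matrix.det (1 + (Polynomial.X : Polynomial ℝ) •
          ((N t)⁻¹ * N').map Polynomial.C)).divX.divX
    have h5 := ((((hasDerivAt_id (0 : ℝ)).const_mul ((N t)⁻¹ * N').trace).const_add 1).add
      ((q.hasDerivAt 0).mul ((hasDerivAt_id (0 : ℝ)).pow 2))).const_mul (N t).det
    simpa using h5
  rw [← h2.unique h3]
  exact h1

/-- Cramer's rule gives differentiability of the entries; the value then follows by differentiating
`N * N⁻¹ = 1`. -/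
theorem inv {N : ℝ → Matrix ι ι ℝ} {N' : Matrix ι ι ℝ} (hN : HasMatDerivAt N N' t)
    (hu : ∀ s, IsUnit (N s).det) :
    HasMatDerivAt (fun s => (N s)⁻¹) (-((N t)⁻¹ * N' * (N t)⁻¹)) t := by
  have hd : ∀ i j, DifferentiableAt ℝ (fun s => (N s)⁻¹ i j) t := by
    intro i j
    have h1 : (fun s => (N s)⁻¹ i j) =
        fun s => ((N s).det)⁻¹ * ((N s).updateRow j (Pi.single i 1)).det := by
      funext s
      rw [Matrix.inv_def, Ring.inverse_eq_inv', Matrix.smul_apply, Matrix.adjugate_apply,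
        smul_eq_mul]
    rw [h1]
    refine (hN.differentiableAt_det.inv (hu t).ne_zero).mul ?_
    have h2 : HasMatDerivAt (fun s => (N s).updateRow j (Pi.single i 1)) (N'.updateRow j 0) t := by
      intro k l
      by_cases hk : k = j
      · subst hk
        simpa using hasDerivAt_const t _
      · simpa [Matrix.updateRow_apply, hk] using hN k l
    exact h2.differentiableAt_det
  let D : Matrix ι ι ℝ := Matrix.of fun i j => deriv (fun s => (N s)⁻¹ i j) t
  have hD : HasMatDerivAt (fun s => (N s)⁻¹) D t := fun i j => (hd i j).hasDerivAt
  have h1 : N' * (N t)⁻¹ + N t * D = 0 := by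
    have h2 := hN.mul hD
    have h3 : (fun s => N s * (N s)⁻¹) = fun _ => 1 :=
      funext fun s => Matrix.mul_nonsing_inv _ (hu s)
    rw [h3] at h2
    exact h2.unique (hasMatDerivAt_const 1)
  have h2 : D = -((N t)⁻¹ * N' * (N t)⁻¹) := by
    rw [eq_neg_iff_add_eq_zero, add_comm, ← Matrix.nonsing_inv_mul_cancel_left _ D (hu t),
      Matrix.mul_assoc, ← Matrix.mul_add, h1, Matrix.mul_zero]
  exact h2 ▸ hD

end HasMatDerivAt

end curves

/-! ### The derivative of the canonical metric -/

section metric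

/-- The matrix `(1 + Z Zᵀ)⁻¹`. -/
def leftInv (Z : Matrix (Fin n) (Fin m) ℝ) : Matrix (Fin n) (Fin n) ℝ := (1 + Z * Zᵀ)⁻¹

theorem isUnit_det_one_add (Z : Matrix (Fin n) (Fin m) ℝ) : IsUnit (1 + Z * Zᵀ).det :=
  (det_one_add_pos Z).ne'.isUnit

theorem leftInv_transpose (Z : Matrix (Fin n) (Fin m) ℝ) : (leftInv Z)ᵀ = leftInv Z := by
  rw [leftInv, Matrix.transpose_nonsing_inv, Matrix.transpose_add, Matrix.transpose_mul,
    Matrix.transpose_one, Matrix.transpose_transpose]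

theorem metric_eq (Z X Y : Matrix (Fin n) (Fin m) ℝ) :
    metric Z X Y = (leftInv Z * X * leftInv Zᵀ * Yᵀ).trace := rfl

/-- `Zᵀ (1 + Z Zᵀ)⁻¹ = (1 + Zᵀ Z)⁻¹ Zᵀ`. -/
theorem transpose_mul_leftInv (Z : Matrix (Fin n) (Fin m) ℝ) :
    Zᵀ * leftInv Z = leftInv Zᵀ * Zᵀ := by
  have h : (1 + Zᵀ * Zᵀᵀ) * Zᵀ = Zᵀ * (1 + Z * Zᵀ) := by
    simp [Matrix.add_mul, Matrix.mul_add, Matrix.mul_assoc]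
  rw [leftInv, leftInv, ← Matrix.nonsing_inv_mul_cancel_left _ (Zᵀ * _) (isUnit_det_one_add Zᵀ),
    ← Matrix.mul_assoc _ Zᵀ, h, Matrix.mul_nonsing_inv_cancel_right _ _ (isUnit_det_one_add Z)]

theorem mul_leftInv_transpose (Z : Matrix (Fin n) (Fin m) ℝ) :
    Z * leftInv Zᵀ = leftInv Z * Z := by
  have h := transpose_mul_leftInv Zᵀ
  rwa [Matrix.transpose_transpose] at h

theorem HasMatDerivAt.leftInv {Z : ℝ → Matrix (Fin n) (Fin m) ℝ} {Z' : Matrix (Fin n) (Fin m) ℝ}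
    {t : ℝ} (hZ : HasMatDerivAt Z Z' t) :
    HasMatDerivAt (fun s => Grass.leftInv (Z s))
      (-(Grass.leftInv (Z t) * (Z' * (Z t)ᵀ + Z t * Z'ᵀ) * Grass.leftInv (Z t))) t := by
  have h := ((hasMatDerivAt_const (t := t) 1).add (hZ.mul hZ.transpose)).inv
    fun s => isUnit_det_one_add (Z s)
  rw [zero_add] at h
  exact h

/-- The trilinear form through which the derivative of the metric is expressed. -/
def cubic (Z P Q R : Matrix (Fin n) (Fin m) ℝ) : ℝ :=
  (leftInv Z * P * (Zᵀ * leftInv Z) * Q * leftInv Zᵀ * Rᵀ).trace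

/-- Each of the two inverses contributes two terms. Transposition, cyclicity of the trace and the
exchange rule `Zᵀ A = B Zᵀ`, with `B = (1 + Zᵀ Z)⁻¹`, bring all four to the shape of `cubic`. -/
theorem HasMatDerivAt.metric {Z : ℝ → Matrix (Fin n) (Fin m) ℝ} {W : Matrix (Fin n) (Fin m) ℝ}
    {t : ℝ} (hZ : HasMatDerivAt Z W t) (X Y : Matrix (Fin n) (Fin m) ℝ) :
    HasDerivAt (fun s => Grass.metric (Z s) X Y)
      (-(cubic (Z t) W X Y + cubic (Z t) W Y X + cubic (Z t) Y W X + cubic (Z t) X W Y)) t := by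
  have h := (((hZ.leftInv.mul (hasMatDerivAt_const X)).mul hZ.transpose.leftInv).mul
    (hasMatDerivAt_const Yᵀ)).trace
  refine h.congr_deriv ?_
  generalize hA : Grass.leftInv (Z t) = A
  generalize hB : Grass.leftInv (Z t)ᵀ = B
  have hAt : Aᵀ = A := hA ▸ leftInv_transpose _
  have hBt : Bᵀ = B := hB ▸ leftInv_transpose _
  have hS : (Z t)ᵀ * A = B * (Z t)ᵀ := hA ▸ hB ▸ transpose_mul_leftInv _
  have hS' : A * Z t = Z t * B := hA ▸ hB ▸ (mul_leftInv_transpose _).symm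
  simp only [cubic, hA, hB]
  generalize Z t = Z at *
  have e1 : (A * W * (Zᵀ * A) * Y * B * Xᵀ).trace = (A * (Z * Wᵀ) * A * X * B * Yᵀ).trace := by
    rw [← Matrix.trace_transpose]
    simp only [Matrix.transpose_mul, Matrix.transpose_transpose, hAt, hBt]
    rw [Matrix.trace_mul_comm X, Matrix.mul_assoc, Matrix.trace_mul_comm]
    simp only [Matrix.mul_assoc]
    rw [Matrix.trace_mul_comm]
    simp only [Matrix.mul_assoc]
  have e2 : (A * Y * (Zᵀ * A) * W * B * Xᵀ).trace = (A * X * (B * (Wᵀ * Z) * B) * Yᵀ).trace := by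
    rw [← Matrix.trace_transpose]
    simp only [Matrix.transpose_mul, Matrix.transpose_transpose, hAt, hBt]
    rw [show X * (B * (Wᵀ * (A * Z * (Yᵀ * A)))) = X * (B * (Wᵀ * (A * Z * Yᵀ))) * A by
      simp only [Matrix.mul_assoc], Matrix.trace_mul_comm, hS']
    simp only [Matrix.mul_assoc]
  have e3 : (A * X * (Zᵀ * A) * W * B * Yᵀ).trace = (A * X * (B * (Zᵀ * W) * B) * Yᵀ).trace := by
    rw [hS]; simp only [Matrix.mul_assoc]
  rw [e1, e2, e3]
  simp only [Matrix.transpose_transpose, Matrix.mul_zero, add_zero, Matrix.mul_add,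
    Matrix.add_mul, Matrix.mul_neg, Matrix.neg_mul, Matrix.trace_add, Matrix.trace_neg,
    Matrix.mul_assoc]
  ring

end metric

/-! ### The Levi-Civita connection -/

section connection

theorem metric_coordVec (Z X : Matrix (Fin n) (Fin m) ℝ) (d : Fin n × Fin m) :
    metric Z X (coordVec d) = (leftInv Z * X * leftInv Zᵀ) d.1 d.2 := by
  rw [metric_eq, coordVec, Matrix.transpose_single, Matrix.trace_mul_single]
  simp

/-- The Kronecker form makes invertibility of the metric immediate. -/
theorem metricMatrix_eq (Z : Matrix (Fin n) (Fin m) ℝ) :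
    metricMatrix Z = leftInv Z ⊗ₖ leftInv Zᵀ := by
  ext ⟨i, j⟩ ⟨k, l⟩
  rw [metricMatrix, Matrix.of_apply, metric_coordVec, coordVec, Matrix.kronecker_apply,
    ← Matrix.transpose_apply (leftInv Z), leftInv_transpose]
  simp [Matrix.mul_apply, Matrix.single_apply, ite_and]

theorem isUnit_det_metricMatrix (Z : Matrix (Fin n) (Fin m) ℝ) :
    IsUnit (metricMatrix Z).det := by
  have h1 : (leftInv Z).det ≠ 0 :=
    (Matrix.isUnit_nonsing_inv_det _ (isUnit_det_one_add Z)).ne_zero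
  have h2 : (leftInv Zᵀ).det ≠ 0 :=
    (Matrix.isUnit_nonsing_inv_det _ (isUnit_det_one_add Zᵀ)).ne_zero
  rw [metricMatrix_eq, Matrix.det_kronecker]
  exact (mul_ne_zero (pow_ne_zero _ h1) (pow_ne_zero _ h2)).isUnit

theorem sum_metricMatrix_mul (Z X : Matrix (Fin n) (Fin m) ℝ) (d : Fin n × Fin m) :
    ∑ e, metricMatrix Z d e * X e.1 e.2 = metric Z X (coordVec d) := by
  rw [metric_coordVec, metricMatrix_eq, Fintype.sum_prod_type, Matrix.mul_apply,
    Finset.sum_comm]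
  refine Finset.sum_congr rfl fun j _ => ?_
  rw [Matrix.mul_apply, Finset.sum_mul]
  refine Finset.sum_congr rfl fun i _ => ?_
  rw [Matrix.kronecker_apply, ← Matrix.transpose_apply (leftInv Zᵀ) d.2 j, leftInv_transpose]
  ring

theorem partialDeriv_metricMatrix (Z : Matrix (Fin n) (Fin m) ℝ) (d a b : Fin n × Fin m) :
    partialDeriv d (fun Z' => metricMatrix Z' a b) Z =
      -(cubic Z (coordVec d) (coordVec a) (coordVec b)
        + cubic Z (coordVec d) (coordVec b) (coordVec a)
        + cubic Z (coordVec b) (coordVec d) (coordVec a)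
        + cubic Z (coordVec a) (coordVec d) (coordVec b)) := by
  have h := ((hasMatDerivAt_line (t := 0) Z (coordVec d)).metric (coordVec a) (coordVec b)).deriv
  simp only [zero_smul, add_zero] at h
  exact h

/-- The Christoffel tensor of the canonical metric. -/
def connection (Z X Y : Matrix (Fin n) (Fin m) ℝ) : Matrix (Fin n) (Fin m) ℝ :=
  -(X * (Zᵀ * leftInv Z) * Y + Y * (Zᵀ * leftInv Z) * X)

theorem metric_connection (Z X Y W : Matrix (Fin n) (Fin m) ℝ) :
    metric Z (connection Z X Y) W = -(cubic Z X Y W + cubic Z Y X W) := by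
  simp only [metric_eq, connection, cubic, Matrix.mul_add, Matrix.add_mul, Matrix.mul_neg,
    Matrix.neg_mul, Matrix.trace_add, Matrix.trace_neg, Matrix.mul_assoc]

/-- In the Koszul combination of twelve `cubic` terms, only those ending in the direction `d`
survive, each twice. They are the pairing of `connection` with `d`, and the metric is nonsingular.
-/
theorem christoffel_eq (Z : Matrix (Fin n) (Fin m) ℝ) (a b c : Fin n × Fin m) :
    christoffel Z a b c = connection Z (coordVec a) (coordVec b) c.1 c.2 := by
  have h1 : ∀ d, -partialDeriv d (fun Z' => metricMatrix Z' a b) Z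
      + partialDeriv a (fun Z' => metricMatrix Z' b d) Z
      + partialDeriv b (fun Z' => metricMatrix Z' d a) Z =
      2 * (metricMatrix Z).mulVec
        (fun e => connection Z (coordVec a) (coordVec b) e.1 e.2) d := by
    intro d
    rw [Matrix.mulVec, dotProduct, sum_metricMatrix_mul, metric_connection]
    simp only [partialDeriv_metricMatrix]
    ring
  have h2 : ((metricMatrix Z)⁻¹.mulVec ((metricMatrix Z).mulVec
      fun e => connection Z (coordVec a) (coordVec b) e.1 e.2)) c =
      connection Z (coordVec a) (coordVec b) c.1 c.2 := by
    rw [Matrix.mulVec_mulVec, Matrix.nonsing_inv_mul _ (isUnit_det_metricMatrix Z),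
      Matrix.one_mulVec]
  rw [christoffel, ← h2, Matrix.mulVec, dotProduct, Finset.mul_sum]
  refine Finset.sum_congr rfl fun d _ => ?_
  rw [h1]
  ring

end connection

/-! ### First and second derivatives of `v` -/

section hessian

theorem vCoord_pos (Z : Matrix (Fin n) (Fin m) ℝ) : 0 < vCoord Z :=
  Real.sqrt_pos.2 (det_one_add_pos Z)

/-- The logarithmic derivative of `v`. -/
def logDiff (Z X : Matrix (Fin n) (Fin m) ℝ) : ℝ := (leftInv Z * X * Zᵀ).trace

/-- Jacobi's formula for the determinant. The two halves of the derivative of `Z Zᵀ` have equal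
trace, which cancels the factor 2 of the square root. -/
theorem HasMatDerivAt.vCoord {Z : ℝ → Matrix (Fin n) (Fin m) ℝ} {Z' : Matrix (Fin n) (Fin m) ℝ}
    {t : ℝ} (hZ : HasMatDerivAt Z Z' t) :
    HasDerivAt (fun s => Grass.vCoord (Z s)) (Grass.vCoord (Z t) * logDiff (Z t) Z') t := by
  have h := (((hasMatDerivAt_const (t := t) 1).add (hZ.mul hZ.transpose)).det
    (isUnit_det_one_add (Z t))).sqrt (det_one_add_pos (Z t)).ne'
  refine h.congr_deriv ?_
  have h1 : (Grass.leftInv (Z t) * (Z t * Z'ᵀ)).trace = logDiff (Z t) Z' := by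
    rw [← Matrix.trace_transpose, logDiff, Matrix.transpose_mul, Matrix.transpose_mul,
      Matrix.transpose_transpose, leftInv_transpose, Matrix.trace_mul_comm, Matrix.mul_assoc]
  have h2 : (Grass.leftInv (Z t) * (Z' * (Z t)ᵀ)).trace = logDiff (Z t) Z' := by
    rw [logDiff, Matrix.mul_assoc]
  have h3 := vCoord_pos (Z t)
  have h4 : (1 + Z t * (Z t)ᵀ).det = Grass.vCoord (Z t) ^ 2 :=
    (Real.sq_sqrt (det_one_add_pos (Z t)).le).symm
  change ((1 + Z t * (Z t)ᵀ).det *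
    (Grass.leftInv (Z t) * (0 + (Z' * (Z t)ᵀ + Z t * Z'ᵀ))).trace) / (2 * Grass.vCoord (Z t)) = _
  rw [zero_add, Matrix.mul_add, Matrix.trace_add, h1, h2, h4]
  field_simp
  ring

/-- The closed form of the Hessian of `v`. -/
def hessForm (Z X Y : Matrix (Fin n) (Fin m) ℝ) : ℝ :=
  vCoord Z * (metric Z X Y + logDiff Z X * logDiff Z Y
    + (leftInv Z * X * Zᵀ * (leftInv Z * Y * Zᵀ)).trace)

theorem metric_comm (Z X Y : Matrix (Fin n) (Fin m) ℝ) : metric Z X Y = metric Z Y X := by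
  rw [metric_eq, metric_eq, ← Matrix.trace_transpose]
  simp only [Matrix.transpose_mul, Matrix.transpose_transpose, leftInv_transpose]
  rw [← Matrix.mul_assoc, ← Matrix.mul_assoc, Matrix.trace_mul_comm]
  simp only [Matrix.mul_assoc]

theorem transpose_mul_leftInv_mul (Z : Matrix (Fin n) (Fin m) ℝ) :
    Zᵀ * leftInv Z * Z = 1 - leftInv Zᵀ := by
  have h := Matrix.nonsing_inv_mul _ (isUnit_det_one_add Zᵀ)
  rw [Matrix.mul_add, Matrix.mul_one, Matrix.transpose_transpose] at h
  rw [transpose_mul_leftInv, Matrix.mul_assoc, eq_sub_iff_add_eq, add_comm]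
  exact h

/-- This is `d/dt (dv(Y)) = Hess v (Z', Y) + dv(∇_{Z'} Y)` for a field `Y` along a curve. Constant
`Y` on a line identifies the Hessian; `Y = Z'` on a geodesic gives the second derivative of `v`. -/
theorem HasMatDerivAt.logDiff {Z Y : ℝ → Matrix (Fin n) (Fin m) ℝ}
    {Z' Y' : Matrix (Fin n) (Fin m) ℝ} {t : ℝ} (hZ : HasMatDerivAt Z Z' t)
    (hY : HasMatDerivAt Y Y' t) :
    HasDerivAt (fun s => Grass.vCoord (Z s) * Grass.logDiff (Z s) (Y s))
      (hessForm (Z t) Z' (Y t) +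
        Grass.vCoord (Z t) * Grass.logDiff (Z t) (Y' + connection (Z t) Z' (Y t))) t := by
  have h := hZ.vCoord.mul ((hZ.leftInv.mul hY).mul hZ.transpose).trace
  refine h.congr_deriv ?_
  -- The variation of `Zᵀ` and half of the variation of the inverse combine to the metric, by `Zᵀ A
  -- Z = 1 - (1 + Zᵀ Z)⁻¹`.
  have h1 : (Grass.leftInv (Z t) * Y t * Z'ᵀ).trace -
      (Grass.leftInv (Z t) * (Z t * Z'ᵀ) * Grass.leftInv (Z t) * Y t * (Z t)ᵀ).trace =
      Grass.metric (Z t) Z' (Y t) := by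
    have e : (Grass.leftInv (Z t) * (Z t * Z'ᵀ) * Grass.leftInv (Z t) * Y t * (Z t)ᵀ).trace =
        (Grass.leftInv (Z t) * Y t * ((Z t)ᵀ * Grass.leftInv (Z t) * Z t) * Z'ᵀ).trace := by
      rw [show Grass.leftInv (Z t) * (Z t * Z'ᵀ) * Grass.leftInv (Z t) * Y t * (Z t)ᵀ =
        (Grass.leftInv (Z t) * (Z t * Z'ᵀ)) * (Grass.leftInv (Z t) * Y t * (Z t)ᵀ) by
          simp only [Matrix.mul_assoc], Matrix.trace_mul_comm]
      simp only [Matrix.mul_assoc]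
    rw [metric_comm, metric_eq, e, transpose_mul_leftInv_mul, Matrix.mul_sub, Matrix.mul_one,
      Matrix.sub_mul, Matrix.trace_sub]
    ring
  have h2 : (Grass.leftInv (Z t) * Y t * (Z t)ᵀ * (Grass.leftInv (Z t) * Z' * (Z t)ᵀ)).trace =
      (Grass.leftInv (Z t) * Z' * (Z t)ᵀ * (Grass.leftInv (Z t) * Y t * (Z t)ᵀ)).trace :=
    Matrix.trace_mul_comm _ _
  rw [hessForm, ← h1]
  simp only [Grass.logDiff, connection, Matrix.mul_add, Matrix.add_mul, Matrix.mul_neg,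
    Matrix.neg_mul, Matrix.trace_add, Matrix.trace_neg, Matrix.mul_assoc] at h2 ⊢
  rw [h2]
  ring

theorem partialDeriv_vCoord (Z : Matrix (Fin n) (Fin m) ℝ) (b : Fin n × Fin m) :
    partialDeriv b vCoord Z = vCoord Z * logDiff Z (coordVec b) := by
  have h := (hasMatDerivAt_line (t := 0) Z (coordVec b)).vCoord.deriv
  simp only [zero_smul, add_zero] at h
  exact h

/-- The differential of `v` as a linear form. -/
def diffLinear (Z : Matrix (Fin n) (Fin m) ℝ) : Matrix (Fin n) (Fin m) ℝ →ₗ[ℝ] ℝ where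
  toFun X := vCoord Z * logDiff Z X
  map_add' X Y := by
    simp only [logDiff, Matrix.mul_add, Matrix.add_mul, Matrix.trace_add, mul_add]
  map_smul' r X := by
    simp only [logDiff, Matrix.mul_smul, Matrix.smul_mul, Matrix.trace_smul, smul_eq_mul,
      RingHom.id_apply]
    ring

/-- The Hessian of `v` as a bilinear form. -/
def hessBilin (Z : Matrix (Fin n) (Fin m) ℝ) :
    Matrix (Fin n) (Fin m) ℝ →ₗ[ℝ] Matrix (Fin n) (Fin m) ℝ →ₗ[ℝ] ℝ :=
  LinearMap.mk₂ ℝ (hessForm Z)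
    (fun X X' Y => by
      simp only [hessForm, metric_eq, logDiff, Matrix.mul_add, Matrix.add_mul, Matrix.trace_add]
      ring)
    (fun r X Y => by
      simp only [hessForm, metric_eq, logDiff, Matrix.mul_smul, Matrix.smul_mul,
        Matrix.trace_smul, smul_eq_mul]
      ring)
    (fun X Y Y' => by
      simp only [hessForm, metric_eq, logDiff, Matrix.mul_add, Matrix.add_mul, Matrix.trace_add,
        Matrix.transpose_add]
      ring)
    (fun r X Y => by
      simp only [hessForm, metric_eq, logDiff, Matrix.mul_smul, Matrix.smul_mul,
        Matrix.trace_smul, smul_eq_mul, Matrix.transpose_smul]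
      ring)

/-- The connection as a bilinear map. -/
def connectionBilin (Z : Matrix (Fin n) (Fin m) ℝ) : Matrix (Fin n) (Fin m) ℝ →ₗ[ℝ]
    Matrix (Fin n) (Fin m) ℝ →ₗ[ℝ] Matrix (Fin n) (Fin m) ℝ :=
  LinearMap.mk₂ ℝ (connection Z)
    (fun X X' Y => by
      simp only [connection, Matrix.mul_add, Matrix.add_mul]
      abel)
    (fun r X Y => by
      simp only [connection, Matrix.mul_smul, Matrix.smul_mul, smul_add, smul_neg])
    (fun X Y Y' => by
      simp only [connection, Matrix.mul_add, Matrix.add_mul]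
      abel)
    (fun r X Y => by
      simp only [connection, Matrix.mul_smul, Matrix.smul_mul, smul_add, smul_neg])

theorem eq_sum_coordVec (X : Matrix (Fin n) (Fin m) ℝ) :
    X = ∑ a : Fin n × Fin m, X a.1 a.2 • coordVec a := by
  rw [Fintype.sum_prod_type]
  conv_lhs => rw [Matrix.matrix_eq_sum_single X]
  simp [coordVec, Matrix.smul_single]

theorem sum_mul_linear {V : Type*} [AddCommGroup V] [Module ℝ V]
    (L : Matrix (Fin n) (Fin m) ℝ →ₗ[ℝ] V) (X : Matrix (Fin n) (Fin m) ℝ) :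
    ∑ a : Fin n × Fin m, X a.1 a.2 • L (coordVec a) = L X := by
  conv_rhs => rw [eq_sum_coordVec X, map_sum]
  simp only [map_smul]

theorem sum_mul_bilinear {V : Type*} [AddCommGroup V] [Module ℝ V]
    (L : Matrix (Fin n) (Fin m) ℝ →ₗ[ℝ] Matrix (Fin n) (Fin m) ℝ →ₗ[ℝ] V)
    (X Y : Matrix (Fin n) (Fin m) ℝ) :
    ∑ a : Fin n × Fin m, ∑ b : Fin n × Fin m,
      (X a.1 a.2 * Y b.1 b.2) • L (coordVec a) (coordVec b) = L X Y := by
  simp only [mul_smul, ← Finset.smul_sum, sum_mul_linear]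
  exact (congrArg (fun f : _ →ₗ[ℝ] V => f Y) (sum_mul_linear L X)) ▸ by simp

theorem hessComponent_vCoord (Z : Matrix (Fin n) (Fin m) ℝ) (a b : Fin n × Fin m) :
    hessComponent vCoord Z a b = hessForm Z (coordVec a) (coordVec b) := by
  have h1 : partialDeriv b vCoord =
      fun Z : Matrix (Fin n) (Fin m) ℝ => vCoord Z * logDiff Z (coordVec b) :=
    funext fun Z => partialDeriv_vCoord Z b
  have h2 := ((hasMatDerivAt_line (t := 0) Z (coordVec a)).logDiff
    (hasMatDerivAt_const (coordVec b))).deriv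
  simp only [zero_smul, add_zero, zero_add] at h2
  have h3 : ∑ c, christoffel Z a b c * partialDeriv c vCoord Z =
      vCoord Z * logDiff Z (connection Z (coordVec a) (coordVec b)) := by
    simp only [christoffel_eq, partialDeriv_vCoord]
    exact sum_mul_linear (diffLinear Z) _
  rw [hessComponent, h1, h3]
  exact (congrArg (· - _) h2).trans (add_sub_cancel_right _ _)

end hessian

/-! ### Diagonalisation at a point -/

section pointwise

theorem trace_conj_diagonal_mul (Q N : Matrix (Fin n) (Fin n) ℝ) (a : Fin n → ℝ) :
    (Q * Matrix.diagonal a * Qᵀ * N).trace = ∑ i, a i * (Qᵀ * N * Q) i i := by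
  rw [show Q * Matrix.diagonal a * Qᵀ * N = Q * (Matrix.diagonal a * (Qᵀ * N)) by
    simp only [Matrix.mul_assoc], Matrix.trace_mul_comm, Matrix.mul_assoc]
  simp only [Matrix.trace, Matrix.diag_apply, Matrix.diagonal_mul]

/-- In rows rotated to diagonalise `Z Zᵀ`, the metric and the quadratic terms of the Hessian of `v`
are expressed through the rescaled components `η` of `X`; the metric only up to the part of `X`
orthogonal to the rows of `Z`. -/
theorem exists_rescaled_components {Z : Matrix (Fin n) (Fin m) ℝ} {Q : Matrix (Fin n) (Fin n) ℝ}
    {a : Fin n → ℝ} (hQ : Q * Qᵀ = 1) (ha : leftInv Z = Q * Matrix.diagonal a * Qᵀ) :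
    (∀ i, 0 < a i) ∧ (∀ i, a i ≤ 1) ∧ ∀ X : Matrix (Fin n) (Fin m) ℝ, ∃ η : Fin n → Fin n → ℝ,
      ∑ i, ∑ k, a i * a k * η i k ^ 2 ≤ metric Z X X ∧
      logDiff Z X = ∑ i, √((a i)⁻¹ - 1) * (a i * η i i) ∧
      (leftInv Z * X * Zᵀ * (leftInv Z * X * Zᵀ)).trace =
        ∑ i, ∑ k, a i * a k * (√((a i)⁻¹ - 1) * √((a k)⁻¹ - 1)) * (η i k * η k i) := by
  have hQ' : Qᵀ * Q = 1 := mul_eq_one_comm.1 hQ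
  set y := Qᵀ * Z with hy
  have hyy : ∀ i j, a i * ((1 : Matrix (Fin n) (Fin n) ℝ) i j + (y * yᵀ) i j) =
      (1 : Matrix (Fin n) (Fin n) ℝ) i j := by
    have h1 : Matrix.diagonal a * (1 + y * yᵀ) = 1 := by
      have h2 : leftInv Z * (1 + Z * Zᵀ) = 1 := Matrix.nonsing_inv_mul _ (isUnit_det_one_add Z)
      calc Matrix.diagonal a * (1 + y * yᵀ)
          = (Qᵀ * Q) * Matrix.diagonal a * (Qᵀ * Q + y * yᵀ) := by rw [hQ', Matrix.one_mul]
        _ = Qᵀ * ((Q * Matrix.diagonal a * Qᵀ) * (1 + Z * Zᵀ)) * Q := by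
          rw [hy, Matrix.transpose_mul, Matrix.transpose_transpose]
          simp only [Matrix.mul_add, Matrix.add_mul, Matrix.mul_assoc, Matrix.mul_one]
        _ = 1 := by rw [← ha, h2, Matrix.mul_one, hQ']
    intro i j
    have h3 := congrFun (congrFun h1 i) j
    rwa [Matrix.diagonal_mul] at h3
  have hd : ∀ i, 0 ≤ (y * yᵀ) i i := fun i => by
    rw [Matrix.mul_apply]
    exact Finset.sum_nonneg fun k _ => mul_self_nonneg _
  have hpos : ∀ i, 0 < a i := fun i => by
    have h := hyy i i
    rw [Matrix.one_apply_eq] at h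
    nlinarith [hd i]
  have hle : ∀ i, a i ≤ 1 := fun i => by
    have h := hyy i i
    rw [Matrix.one_apply_eq] at h
    nlinarith [mul_nonneg (hpos i).le (hd i)]
  refine ⟨hpos, hle, fun X => ?_⟩
  set l : Fin n → ℝ := fun i => √((a i)⁻¹ - 1) with hl
  have hlsq : ∀ i, l i ^ 2 = (a i)⁻¹ - 1 := fun i =>
    Real.sq_sqrt (sub_nonneg.2 ((one_le_inv₀ (hpos i)).2 (hle i)))
  -- The rows of `y` are mutually orthogonal, with lengths `l i`.
  have hyd : y * yᵀ = Matrix.diagonal fun i => l i ^ 2 := by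
    ext i j
    have h := hyy i j
    rw [Matrix.diagonal_apply, hlsq]
    by_cases hij : i = j
    · subst hij
      rw [Matrix.one_apply_eq] at h
      rw [if_pos rfl, eq_sub_iff_add_eq', ← mul_right_inj' (hpos i).ne', h,
        mul_inv_cancel₀ (hpos i).ne']
    · rw [Matrix.one_apply_ne hij, zero_add] at h
      rw [if_neg hij]
      exact (mul_eq_zero.1 h).resolve_left (hpos i).ne'
  set x := Qᵀ * X with hx
  set ξ := x * yᵀ with hξ
  -- The component of row `i` of `x` along the unit vector `y k / l k`. If `l k = 0`, the division
  -- returns `0`, which is consistent because then `y k = 0`.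
  let η : Matrix (Fin n) (Fin n) ℝ := Matrix.of fun i k => ξ i k / l k
  have hη : ∀ i k, ξ i k = l k * η i k := fun i k => by
    by_cases h : l k = 0
    · have h0 : ∑ j, y k j * y k j = 0 := by
        have h1 := congrFun (congrFun hyd k) k
        rw [Matrix.diagonal_apply_eq, h, Matrix.mul_apply] at h1
        simpa using h1
      have h2 : ∀ j, y k j = 0 := fun j => by
        have := (Finset.sum_eq_zero_iff_of_nonneg fun j _ => mul_self_nonneg (y k j)).1 h0 j
          (Finset.mem_univ j)
        simpa using this
      rw [h, zero_mul, hξ, Matrix.mul_apply]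
      exact Finset.sum_eq_zero fun j _ => by rw [Matrix.transpose_apply, h2, mul_zero]
    · simp only [η, Matrix.of_apply]
      field_simp
  have hM : Qᵀ * (X * Zᵀ) * Q = ξ := by
    rw [hξ, hx, hy, Matrix.transpose_mul, Matrix.transpose_transpose]
    simp only [Matrix.mul_assoc]
  -- Bessel's inequality: `C * y` is the orthogonal projection of the rows of `x` to the span of the
  -- rows of `y`.
  have hBessel : ∀ i, ∑ k, η i k ^ 2 ≤ (x * xᵀ) i i := by
    intro i
    let C : Matrix (Fin n) (Fin n) ℝ := Matrix.of fun i k => η i k / l k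
    have h1 : 0 ≤ ((x - C * y) * (x - C * y)ᵀ) i i := by
      rw [Matrix.mul_apply]
      exact Finset.sum_nonneg fun k _ => mul_self_nonneg _
    have h2 : (x - C * y) * (x - C * y)ᵀ =
        x * xᵀ - ξ * Cᵀ - (ξ * Cᵀ)ᵀ + C * Matrix.diagonal (fun i => l i ^ 2) * Cᵀ := by
      rw [← hyd, hξ]
      simp only [Matrix.transpose_sub, Matrix.transpose_mul, Matrix.transpose_transpose,
        Matrix.sub_mul, Matrix.mul_sub, Matrix.mul_assoc]
      abel
    have h3 : (ξ * Cᵀ) i i = ∑ k, η i k ^ 2 := by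
      rw [Matrix.mul_apply]
      refine Finset.sum_congr rfl fun k _ => ?_
      simp only [C, η, Matrix.transpose_apply, Matrix.of_apply]
      ring
    have h4 : (C * Matrix.diagonal (fun i => l i ^ 2) * Cᵀ) i i = ∑ k, η i k ^ 2 := by
      rw [Matrix.mul_apply]
      refine Finset.sum_congr rfl fun k _ => ?_
      rw [Matrix.mul_diagonal]
      simp only [C, Matrix.transpose_apply, Matrix.of_apply]
      by_cases h : l k = 0
      · simp [η, h]
      · field_simp
    rw [h2, Matrix.add_apply, Matrix.sub_apply, Matrix.sub_apply, Matrix.transpose_apply, h3,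
      h4] at h1
    linarith
  refine ⟨η, ?_, ?_, ?_⟩
  · have h1 : Qᵀ * (X * leftInv Zᵀ * Xᵀ) * Q = x * xᵀ - ξ * Matrix.diagonal a * ξᵀ := by
      have h2 : leftInv Zᵀ = 1 - yᵀ * Matrix.diagonal a * y := by
        rw [← sub_eq_iff_eq_add'.2 (sub_eq_iff_eq_add.1 (transpose_mul_leftInv_mul Z).symm), ha,
          hy, Matrix.transpose_mul, Matrix.transpose_transpose]
        simp only [Matrix.mul_assoc]
      rw [h2, hξ, hx]
      simp only [Matrix.transpose_mul, Matrix.transpose_transpose, Matrix.mul_sub,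
        Matrix.sub_mul, Matrix.mul_assoc, Matrix.mul_one]
    rw [metric_eq, ha, show Q * Matrix.diagonal a * Qᵀ * X * leftInv Zᵀ * Xᵀ =
      Q * Matrix.diagonal a * Qᵀ * (X * leftInv Zᵀ * Xᵀ) by simp only [Matrix.mul_assoc],
      trace_conj_diagonal_mul, h1]
    refine Finset.sum_le_sum fun i _ => ?_
    have h3 : (ξ * Matrix.diagonal a * ξᵀ) i i = ∑ k, (η i k ^ 2 - a k * η i k ^ 2) := by
      rw [Matrix.mul_apply]
      refine Finset.sum_congr rfl fun k _ => ?_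
      rw [Matrix.mul_diagonal, Matrix.transpose_apply, hη]
      have := hlsq k
      have h4 : a k * l k ^ 2 = 1 - a k := by
        rw [this, mul_sub, mul_inv_cancel₀ (hpos k).ne', mul_one]
      linear_combination η i k ^ 2 * h4
    rw [Matrix.sub_apply, h3, Finset.sum_sub_distrib]
    have h5 : ∑ k, a i * a k * η i k ^ 2 = a i * ∑ k, a k * η i k ^ 2 := by
      rw [Finset.mul_sum]
      exact Finset.sum_congr rfl fun k _ => mul_assoc _ _ _
    rw [h5]
    refine mul_le_mul_of_nonneg_left ?_ (hpos i).le
    linarith [hBessel i]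
  · rw [logDiff, Matrix.mul_assoc, ha, trace_conj_diagonal_mul, hM]
    refine Finset.sum_congr rfl fun i _ => ?_
    rw [hη]
    ring
  · have h1 : Qᵀ * (X * Zᵀ * (leftInv Z * (X * Zᵀ))) * Q = ξ * Matrix.diagonal a * ξ := by
      rw [ha, ← hM]
      simp only [Matrix.mul_assoc]
    rw [show leftInv Z * X * Zᵀ * (leftInv Z * X * Zᵀ) =
      leftInv Z * (X * Zᵀ * (leftInv Z * (X * Zᵀ))) by simp only [Matrix.mul_assoc],
      congrArg (fun M => (M * (X * Zᵀ * (leftInv Z * (X * Zᵀ)))).trace) ha,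
      trace_conj_diagonal_mul, h1]
    refine Finset.sum_congr rfl fun i _ => ?_
    rw [Matrix.mul_apply, Finset.mul_sum]
    refine Finset.sum_congr rfl fun k _ => ?_
    rw [Matrix.mul_diagonal, hη, hη]
    ring

/-- The components `η` do not see the part of `X` orthogonal to the rows of `Z`, so definiteness of
the metric is needed separately for the case `η = 0`. -/
theorem metric_pos {Z : Matrix (Fin n) (Fin m) ℝ} {Q : Matrix (Fin n) (Fin n) ℝ}
    {a : Fin n → ℝ} (hQ : Q * Qᵀ = 1) (ha : leftInv Z = Q * Matrix.diagonal a * Qᵀ)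
    {X : Matrix (Fin n) (Fin m) ℝ} (hX : X ≠ 0) : 0 < metric Z X X := by
  have hpos := (exists_rescaled_components hQ ha).1
  have hB : (leftInv Zᵀ).PosDef := (posDef_one_add Zᵀ).inv
  have h1 : ∀ i, (Qᵀ * (X * leftInv Zᵀ * Xᵀ) * Q) i i =
      (Qᵀ * X) i ⬝ᵥ (leftInv Zᵀ).mulVec ((Qᵀ * X) i) := fun i => by
    rw [show Qᵀ * (X * leftInv Zᵀ * Xᵀ) * Q = Qᵀ * X * (leftInv Zᵀ * (Qᵀ * X)ᵀ) by
      rw [Matrix.transpose_mul, Matrix.transpose_transpose]; simp only [Matrix.mul_assoc]]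
    rfl
  rw [metric_eq, ha, show Q * Matrix.diagonal a * Qᵀ * X * leftInv Zᵀ * Xᵀ =
    Q * Matrix.diagonal a * Qᵀ * (X * leftInv Zᵀ * Xᵀ) by simp only [Matrix.mul_assoc],
    trace_conj_diagonal_mul]
  simp only [h1]
  have h2 : ∃ i, (Qᵀ * X) i ≠ 0 := by
    by_contra! h
    refine hX ?_
    rw [← Matrix.one_mul X, ← hQ, Matrix.mul_assoc, show Qᵀ * X = 0 from funext h, Matrix.mul_zero]
  obtain ⟨i, hi⟩ := h2
  refine Finset.sum_pos' (fun k _ => mul_nonneg (hpos k).le ?_)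
    ⟨i, Finset.mem_univ i, mul_pos (hpos i) ?_⟩
  · simpa using hB.posSemidef.dotProduct_mulVec_nonneg ((Qᵀ * X) k)
  · simpa using hB.dotProduct_mulVec_pos hi

end pointwise

/-! ### The scalar inequalities -/

section inequalities

variable {ι : Type*}

/-- Jensen's inequality for `x ↦ 1 / (exp x - c)`, `0 ≤ c < 1`, in the variables `u = exp x`. -/
theorem card_div_le_sum_inv {s : Finset ι} {u : ι → ℝ} {c e : ℝ} (hc : 0 ≤ c) (hc1 : c < 1)
    (he : 1 < e) (hu : ∀ i ∈ s, 1 ≤ u i) (hprod : ∏ i ∈ s, u i = e ^ s.card) :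
    s.card / (e - c) ≤ ∑ i ∈ s, (u i - c)⁻¹ := by
  have hec : 0 < e - c := by linarith
  have he0 : 0 < e := by linarith
  -- The tangent line in `log u` at `u = e`, of slope `-e / (e - c) ^ 2`. After the estimate `1 - 1
  -- / x ≤ log x`, the remaining gap is the fraction in `h3`, nonnegative because `0 ≤ c`.
  have tangent : ∀ i ∈ s, (e - c)⁻¹ - e / (e - c) ^ 2 * Real.log (u i / e) ≤ (u i - c)⁻¹ := by
    intro i hi
    have hui := hu i hi
    have hu0 : 0 < u i := by linarith
    have huc : 0 < u i - c := by linarith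
    have h1 : 1 - (u i / e)⁻¹ ≤ Real.log (u i / e) :=
      Real.one_sub_inv_le_log_of_pos (div_pos hu0 he0)
    have h2 : e / (e - c) ^ 2 * (1 - (u i / e)⁻¹) ≤ e / (e - c) ^ 2 * Real.log (u i / e) :=
      mul_le_mul_of_nonneg_left h1 (by positivity)
    have h3 : (u i - c)⁻¹ - ((e - c)⁻¹ - e / (e - c) ^ 2 * (1 - (u i / e)⁻¹)) =
        c * (u i - e) ^ 2 / ((u i - c) * u i * (e - c) ^ 2) := by
      field_simp
      ring
    have h4 : 0 ≤ c * (u i - e) ^ 2 / ((u i - c) * u i * (e - c) ^ 2) := by positivity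
    linarith
  have hlog : ∑ i ∈ s, Real.log (u i / e) = 0 := by
    rw [← Real.log_prod fun i hi => (div_pos (by linarith [hu i hi]) he0).ne',
      Finset.prod_div_distrib, hprod, Finset.prod_const, div_self (by positivity), Real.log_one]
  calc (s.card : ℝ) / (e - c)
      = ∑ i ∈ s, ((e - c)⁻¹ - e / (e - c) ^ 2 * Real.log (u i / e)) := by
        rw [Finset.sum_sub_distrib, ← Finset.mul_sum, hlog, Finset.sum_const, nsmul_eq_mul]
        ring
    _ ≤ _ := Finset.sum_le_sum tangent

variable [Fintype ι]

theorem sum_sum_eq_sum_sum_symm (f : ι → ι → ℝ) :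
    ∑ i, ∑ k, f i k = ∑ i, ∑ k, (f i k + f k i) / 2 := by
  have h : ∑ i, ∑ k, f k i = ∑ i, ∑ k, f i k := Finset.sum_comm
  simp only [add_div, Finset.sum_add_distrib, ← Finset.sum_div]
  rw [h]
  ring

/-- The diagonal sum is a lower bound of a double sum whose symmetrised terms are nonnegative. -/
theorem sum_diag_le_sum_sum (f : ι → ι → ℝ) (hf : ∀ i k, 0 ≤ f i k + f k i) :
    ∑ i, f i i ≤ ∑ i, ∑ k, f i k := by
  rw [sum_sum_eq_sum_sum_symm]
  refine Finset.sum_le_sum fun i _ => ?_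
  calc f i i = (f i i + f i i) / 2 := by ring
    _ ≤ _ := Finset.single_le_sum (f := fun k => (f i k + f k i) / 2)
      (fun k _ => div_nonneg (hf i k) two_pos.le) (Finset.mem_univ i)

/-- Pairing `(i, k)` with `(k, i)` gives binary forms that are sums of squares with positive leading
weight `1 - l i * l k`; diagonal terms are positive without any bound on `l i`. -/
theorem sum_sq_add_cross_pos {a l : ι → ℝ} {η : ι → ι → ℝ} (ha : ∀ i, 0 < a i)
    (hl : ∀ i, 0 ≤ l i) (hll : ∀ i k, i ≠ k → l i * l k < 1) (hη : ∃ i k, η i k ≠ 0) :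
    0 < ∑ i, ∑ k, (a i * a k * η i k ^ 2 + a i * a k * (l i * l k) * (η i k * η k i)) := by
  have key : ∀ i k, 0 ≤ η i k ^ 2 + η k i ^ 2 + 2 * (l i * l k) * (η i k * η k i) ∧
      (η i k ≠ 0 → 0 < η i k ^ 2 + η k i ^ 2 + 2 * (l i * l k) * (η i k * η k i)) := by
    intro i k
    have h0 := mul_nonneg (hl i) (hl k)
    by_cases h : i = k
    · subst h
      have h1 : 0 ≤ 2 * (l i * l i) * (η i i * η i i) :=
        mul_nonneg (mul_nonneg two_pos.le h0) (mul_self_nonneg _)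
      refine ⟨by linarith [sq_nonneg (η i i)], fun h2 => ?_⟩
      have h3 : 0 < η i i ^ 2 := by positivity
      linarith
    · have h1 := hll i k h
      have e : η i k ^ 2 + η k i ^ 2 + 2 * (l i * l k) * (η i k * η k i) =
        (1 - l i * l k) * (η i k ^ 2 + η k i ^ 2) + l i * l k * (η i k + η k i) ^ 2 := by ring
      rw [e]
      have h2 : 0 < 1 - l i * l k := sub_pos.2 h1
      exact ⟨by positivity, fun h3 => by positivity⟩
  rw [sum_sum_eq_sum_sum_symm]
  have e : ∀ i k, (a i * a k * η i k ^ 2 + a i * a k * (l i * l k) * (η i k * η k i) +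
      (a k * a i * η k i ^ 2 + a k * a i * (l k * l i) * (η k i * η i k))) / 2 =
      a i * a k / 2 * (η i k ^ 2 + η k i ^ 2 + 2 * (l i * l k) * (η i k * η k i)) :=
    fun i k => by ring
  simp only [e]
  have hc : ∀ i k, 0 < a i * a k / 2 := fun i k => half_pos (mul_pos (ha i) (ha k))
  obtain ⟨i, k, h⟩ := hη
  refine Finset.sum_pos' (fun i _ => Finset.sum_nonneg fun k _ =>
    mul_nonneg (hc i k).le (key i k).1) ⟨i, Finset.mem_univ i, ?_⟩
  exact Finset.sum_pos' (fun k _ => mul_nonneg (hc i k).le (key i k).1)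
    ⟨k, Finset.mem_univ k, mul_pos (hc i k) ((key i k).2 h)⟩

/-- Cauchy–Schwarz with weights `v - 1 + l i ^ 2` reduces this to bounding `∑ l i ^ 2 / (v - 1 + l i
^ 2)`. Each term is `1 - (v - 1) / (u i - c)` with `u i = 1 + l i ^ 2` and `c = 2 - v`, so Jensen's
inequality applies; `v ≤ 2` is what makes `c ≥ 0`. -/
theorem sq_sum_le_of_prod_eq {l ζ : ι → ℝ} {v : ℝ} {p : ℕ} (hp : p ≠ 0) (hv1 : 1 < v)
    (hv2 : v ≤ 2) (hprod : v ^ 2 = ∏ i, (1 + l i ^ 2))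
    (hcard : (Finset.univ.filter fun i => l i ≠ 0).card ≤ p) (hpι : p ≤ Fintype.card ι) :
    ((v - 1) / (p * (v ^ ((2 : ℝ) / p) - 1)) + 1 / p) * (∑ i, l i * ζ i) ^ 2 ≤
      ∑ i, (v - 1 + l i ^ 2) * ζ i ^ 2 := by
  -- Exactly `p` indices are kept, including all with `l i ≠ 0`, so that the geometric mean of the
  -- `u i` is `v ^ (2 / p)`.
  obtain ⟨s, hs, -, hsc⟩ := Finset.exists_subsuperset_card_eq
    (Finset.subset_univ (Finset.univ.filter fun i => l i ≠ 0)) hcard hpι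
  have hl0 : ∀ i, i ∉ s → l i = 0 := fun i hi => by
    by_contra h
    exact hi (hs (by simpa using h))
  have hp0 : (0 : ℝ) < p := by exact_mod_cast Nat.pos_of_ne_zero hp
  set e := v ^ ((2 : ℝ) / p) with he
  have he1 : 1 < e := Real.one_lt_rpow hv1 (by positivity)
  have hep : e ^ p = v ^ 2 := by
    rw [he, ← Real.rpow_natCast, ← Real.rpow_mul (by linarith), div_mul_cancel₀ _ hp0.ne']
    norm_num
  have hprod' : ∏ i ∈ s, (1 + l i ^ 2) = e ^ s.card := by
    rw [hsc, hep, hprod]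
    exact Finset.prod_subset (Finset.subset_univ s) fun i _ hi => by simp [hl0 i hi]
  have hJ := card_div_le_sum_inv (c := 2 - v) (by linarith) (by linarith) he1
    (fun i _ => by nlinarith [sq_nonneg (l i)]) hprod'
  rw [hsc] at hJ
  have hpos : ∀ i, 0 < v - 1 + l i ^ 2 := fun i => by nlinarith [sq_nonneg (l i)]
  have hden : 0 < e - (2 - v) := by linarith
  have hsum : ∑ i ∈ s, l i ^ 2 / (v - 1 + l i ^ 2) ≤ p * (e - 1) / (e - (2 - v)) := by
    have h1 : ∀ i ∈ s, l i ^ 2 / (v - 1 + l i ^ 2) =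
        1 - (v - 1) * (1 + l i ^ 2 - (2 - v))⁻¹ := fun i _ => by
      have := hpos i
      rw [show 1 + l i ^ 2 - (2 - v) = v - 1 + l i ^ 2 by ring]
      field_simp
      ring
    rw [Finset.sum_congr rfl h1, Finset.sum_sub_distrib, ← Finset.mul_sum, Finset.sum_const,
      hsc, nsmul_eq_mul, mul_one]
    have h2 := mul_le_mul_of_nonneg_left hJ (by linarith : 0 ≤ v - 1)
    have h3 : (p : ℝ) * (e - 1) / (e - (2 - v)) = p - (v - 1) * (p / (e - (2 - v))) := by
      field_simp
      ring
    linarith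
  have hT : ∑ i, l i * ζ i = ∑ i ∈ s, l i * ζ i :=
    (Finset.sum_subset (Finset.subset_univ s) fun i _ hi => by simp [hl0 i hi]).symm
  have hR : ∑ i ∈ s, (v - 1 + l i ^ 2) * ζ i ^ 2 ≤ ∑ i, (v - 1 + l i ^ 2) * ζ i ^ 2 :=
    Finset.sum_le_sum_of_subset_of_nonneg (Finset.subset_univ s) fun i _ _ =>
      mul_nonneg (hpos i).le (sq_nonneg _)
  have hCS : (∑ i ∈ s, l i * ζ i) ^ 2 ≤ (∑ i ∈ s, l i ^ 2 / (v - 1 + l i ^ 2)) *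
      ∑ i ∈ s, (v - 1 + l i ^ 2) * ζ i ^ 2 :=
    Finset.sum_sq_le_sum_mul_sum_of_sq_le_mul s
      (fun i _ => div_nonneg (sq_nonneg _) (hpos i).le)
      (fun i _ => mul_nonneg (hpos i).le (sq_nonneg _)) fun i _ => by
        have := hpos i
        refine le_of_eq ?_
        field_simp
  have hκ : (v - 1) / (p * (e - 1)) + 1 / p = (e - (2 - v)) / (p * (e - 1)) := by
    have : 0 < e - 1 := by linarith
    field_simp
    ring
  have he2 : 0 < e - 1 := by linarith
  have hκ0 : 0 ≤ (e - (2 - v)) / (p * (e - 1)) := by positivity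
  have hnn : 0 ≤ ∑ i ∈ s, (v - 1 + l i ^ 2) * ζ i ^ 2 :=
    Finset.sum_nonneg fun i _ => mul_nonneg (hpos i).le (sq_nonneg _)
  rw [hκ, hT]
  calc _ ≤ (e - (2 - v)) / (p * (e - 1)) * (p * (e - 1) / (e - (2 - v)) *
        ∑ i ∈ s, (v - 1 + l i ^ 2) * ζ i ^ 2) :=
        mul_le_mul_of_nonneg_left (hCS.trans (mul_le_mul_of_nonneg_right hsum hnn)) hκ0
    _ = ∑ i ∈ s, (v - 1 + l i ^ 2) * ζ i ^ 2 := by field_simp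
    _ ≤ _ := hR

/-- By Cauchy–Schwarz, `(1 + l i * l k) ^ 2 ≤ (1 + l i ^ 2) * (1 + l k ^ 2)`, and the other factors
of the product are at least `1`. -/
theorem mul_le_sub_one_of_prod_eq {l : ι → ℝ} {v : ℝ} (hv : 0 ≤ v)
    (hprod : v ^ 2 = ∏ i, (1 + l i ^ 2)) {i k : ι} (hik : i ≠ k) : l i * l k ≤ v - 1 := by
  classical
  have h1 : ∏ j ∈ {i, k}, (1 + l j ^ 2) ≤ ∏ j, (1 + l j ^ 2) :=
    Finset.prod_le_prod_of_subset_of_one_le (Finset.subset_univ _)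
      (fun j _ => by positivity) fun j _ _ => by nlinarith [sq_nonneg (l j)]
  rw [Finset.prod_pair hik, ← hprod] at h1
  have h2 : (1 + l i * l k) ^ 2 ≤ v ^ 2 := by nlinarith [sq_nonneg (l i - l k)]
  linarith [abs_le_of_sq_le_sq' h2 hv]

/-- The quadratic inequality behind the lower bound of the Hessian of `v`. -/
theorem hessian_lower_bound {a l : ι → ℝ} {η : ι → ι → ℝ} {v : ℝ} {p : ℕ} (hp : p ≠ 0)
    (ha : ∀ i, 0 < a i) (hl : ∀ i, 0 ≤ l i) (hv0 : 0 ≤ v)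
    (hv2 : v ≤ 2) (hprod : v ^ 2 = ∏ i, (1 + l i ^ 2))
    (hcard : (Finset.univ.filter fun i => l i ≠ 0).card ≤ p) (hpι : p ≤ Fintype.card ι) :
    ((v - 1) / (p * (v ^ ((2 : ℝ) / p) - 1)) + 1 / p) * (∑ i, l i * (a i * η i i)) ^ 2 ≤
      (v - 1) * ∑ i, ∑ k, a i * a k * η i k ^ 2 +
        ∑ i, ∑ k, a i * a k * (l i * l k) * (η i k * η k i) := by
  have hv : 1 ≤ v := by
    have h1 : (1 : ℝ) ≤ ∏ i, (1 + l i ^ 2) :=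
      Finset.one_le_prod fun i _ => by nlinarith [sq_nonneg (l i)]
    rw [← hprod] at h1
    nlinarith
  set f : ι → ι → ℝ := fun i k => (v - 1) * (a i * a k * η i k ^ 2) +
    a i * a k * (l i * l k) * (η i k * η k i) with hf
  have hdiag : ∑ i, f i i = ∑ i, (v - 1 + l i ^ 2) * (a i * η i i) ^ 2 :=
    Finset.sum_congr rfl fun i _ => by simp only [hf]; ring
  have hge : ∑ i, f i i ≤ ∑ i, ∑ k, f i k := by
    refine sum_diag_le_sum_sum f fun i k => ?_
    have e : f i k + f k i = a i * a k *
        ((v - 1 - l i * l k) * (η i k ^ 2 + η k i ^ 2) + l i * l k * (η i k + η k i) ^ 2) := by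
      simp only [hf]; ring
    have h0 := mul_nonneg (hl i) (hl k)
    have h2 := mul_nonneg (ha i).le (ha k).le
    by_cases h : i = k
    · subst h
      have e' : f i i + f i i = 2 * ((a i * a i) * ((v - 1 + l i ^ 2) * η i i ^ 2)) := by
        simp only [hf]; ring
      have : 0 ≤ v - 1 + l i ^ 2 := by nlinarith [sq_nonneg (l i)]
      rw [e']
      positivity
    · have h1 : 0 ≤ v - 1 - l i * l k := sub_nonneg.2 (mul_le_sub_one_of_prod_eq hv0 hprod h)
      rw [e]
      positivity
  have hsplit : ∑ i, ∑ k, f i k = (v - 1) * ∑ i, ∑ k, a i * a k * η i k ^ 2 +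
        ∑ i, ∑ k, a i * a k * (l i * l k) * (η i k * η k i) := by
    simp only [hf, Finset.sum_add_distrib, Finset.mul_sum]
  rw [← hsplit]
  refine le_trans ?_ hge
  rw [hdiag]
  -- At `v = 1` the fraction `0 / 0` is `0`, and every `l i` vanishes, so both sides are zero.
  rcases hv.eq_or_lt with h | h
  · have hl0 : ∀ i, l i = 0 := by
      intro i
      have h1 : 1 + l i ^ 2 ≤ ∏ j, (1 + l j ^ 2) := by
        have := Finset.prod_le_prod_of_subset_of_one_le (f := fun j => 1 + l j ^ 2)
          (Finset.subset_univ {i}) (fun j _ => by positivity)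
          fun j _ _ => by nlinarith [sq_nonneg (l j)]
        simpa using this
      rw [← hprod, ← h] at h1
      exact pow_eq_zero_iff two_ne_zero |>.1 (le_antisymm (by linarith) (sq_nonneg (l i)))
    simp [hl0, ← h]
  · exact sq_sum_le_of_prod_eq hp h hv2 hprod hcard hpι

end inequalities

/-! ### Positivity and lower bound of the Hessian form -/

section forms

/-- The matrix `1 - A` has a factor `Z`, hence rank at most `min n m`, and its eigenvalues are the
`1 - a i`. -/
theorem card_ne_one_le {Z : Matrix (Fin n) (Fin m) ℝ} {Q : Matrix (Fin n) (Fin n) ℝ}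
    {a : Fin n → ℝ} (hQ : Q * Qᵀ = 1) (ha : leftInv Z = Q * Matrix.diagonal a * Qᵀ) :
    (Finset.univ.filter fun i => a i ≠ 1).card ≤ min n m := by
  have hQ' : Qᵀ * Q = 1 := mul_eq_one_comm.1 hQ
  have h1 : Matrix.diagonal (fun i => 1 - a i) = Qᵀ * (Z * (leftInv Zᵀ * Zᵀ) * Q) := by
    have h2 := transpose_mul_leftInv_mul Zᵀ
    rw [Matrix.transpose_transpose, Matrix.mul_assoc] at h2
    rw [h2, ha, Matrix.sub_mul, Matrix.mul_sub, Matrix.one_mul, hQ',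
      show Qᵀ * (Q * Matrix.diagonal a * Qᵀ * Q) = (Qᵀ * Q) * Matrix.diagonal a * (Qᵀ * Q) by
        simp only [Matrix.mul_assoc], hQ', Matrix.one_mul, Matrix.mul_one,
      ← Matrix.diagonal_one, Matrix.diagonal_sub]
  have h2 : (Matrix.diagonal fun i => 1 - a i).rank ≤ min n m := by
    rw [h1]
    refine (Matrix.rank_mul_le_right _ _).trans ((Matrix.rank_mul_le_left _ _).trans
      ((Matrix.rank_mul_le_left _ _).trans (le_min ?_ ?_)))
    · simpa using Z.rank_le_height
    · simpa using Z.rank_le_width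
  rw [Matrix.rank_diagonal, Fintype.card_subtype] at h2
  refine le_trans (Finset.card_le_card fun i hi => ?_) h2
  simp only [Finset.mem_filter, Finset.mem_univ, true_and, ne_eq, sub_eq_zero] at hi ⊢
  exact fun h => hi h.symm

theorem vCoord_sq {Z : Matrix (Fin n) (Fin m) ℝ} {Q : Matrix (Fin n) (Fin n) ℝ}
    {a : Fin n → ℝ} (hQ : Q * Qᵀ = 1) (ha : leftInv Z = Q * Matrix.diagonal a * Qᵀ) :
    vCoord Z ^ 2 = ∏ i, (a i)⁻¹ := by
  have h1 := congrArg Matrix.det ha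
  have h2 := congrArg Matrix.det hQ
  rw [Matrix.det_mul, Matrix.det_one] at h2
  rw [leftInv, Matrix.det_nonsing_inv, Ring.inverse_eq_inv', Matrix.det_mul, Matrix.det_mul,
    mul_right_comm, h2, one_mul, Matrix.det_diagonal] at h1
  rw [vCoord, Real.sq_sqrt (det_one_add_pos Z).le, Finset.prod_inv_distrib, ← h1, inv_inv]

theorem hessForm_pos {Z : Matrix (Fin n) (Fin m) ℝ} {Q : Matrix (Fin n) (Fin n) ℝ}
    {a : Fin n → ℝ} (hQ : Q * Qᵀ = 1) (ha : leftInv Z = Q * Matrix.diagonal a * Qᵀ)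
    (haa : ∀ i k, i ≠ k → 1 < a i + a k) {X : Matrix (Fin n) (Fin m) ℝ} (hX : X ≠ 0) :
    0 < hessForm Z X X := by
  obtain ⟨hpos, hle, hX'⟩ := exists_rescaled_components hQ ha
  obtain ⟨η, h1, -, h3⟩ := hX' X
  have hg := metric_pos hQ ha hX
  refine mul_pos (vCoord_pos Z) ?_
  have hT := mul_self_nonneg (logDiff Z X)
  -- If `η = 0`, the cross term vanishes and positivity comes from the metric alone.
  by_cases hη : ∃ i k, η i k ≠ 0
  · have h4 := sum_sq_add_cross_pos (l := fun i => √((a i)⁻¹ - 1)) hpos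
      (fun i => Real.sqrt_nonneg _) (fun i k hik => ?_) hη
    · simp only [Finset.sum_add_distrib] at h4
      rw [h3]
      linarith
    · have h5 := haa i k hik
      have hi := hpos i
      have hk := hpos k
      rw [← Real.sqrt_mul (sub_nonneg.2 ((one_le_inv₀ hi).2 (hle i))), Real.sqrt_lt' one_pos,
        one_pow, show ((a i)⁻¹ - 1) * ((a k)⁻¹ - 1) = (1 - a i) * (1 - a k) / (a i * a k) by
          field_simp, div_lt_one (mul_pos hi hk)]
      linarith
  · push Not at hη
    have h4 : (leftInv Z * X * Zᵀ * (leftInv Z * X * Zᵀ)).trace = 0 := by simp [h3, hη]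
    rw [h4]
    linarith

/-- After division by `v`, the square of `logDiff` already present in the Hessian accounts for the
difference between `(p + 1) / p` and the `1 / p` of `hessian_lower_bound`. The metric bound is used
with the factor `v - 1 ≥ 0`. -/
theorem le_hessForm {Z : Matrix (Fin n) (Fin m) ℝ} {Q : Matrix (Fin n) (Fin n) ℝ}
    {a : Fin n → ℝ} (hQ : Q * Qᵀ = 1) (ha : leftInv Z = Q * Matrix.diagonal a * Qᵀ)
    (hv : vCoord Z ≤ 2) {p : ℕ} (hp : p ≠ 0) (hpm : p = min n m)
    (X : Matrix (Fin n) (Fin m) ℝ) :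
    vCoord Z * (2 - vCoord Z) * metric Z X X +
      ((vCoord Z - 1) / (p * vCoord Z * (vCoord Z ^ ((2 : ℝ) / p) - 1)) +
        (p + 1) / (p * vCoord Z)) * (vCoord Z * logDiff Z X) ^ 2 ≤ hessForm Z X X := by
  obtain ⟨hpos, hle, hX'⟩ := exists_rescaled_components hQ ha
  obtain ⟨η, h1, h2, h3⟩ := hX' X
  have hv0 := vCoord_pos Z
  have hp0 : (0 : ℝ) < p := by exact_mod_cast Nat.pos_of_ne_zero hp
  have hsq : ∀ i, √((a i)⁻¹ - 1) ^ 2 = (a i)⁻¹ - 1 := fun i =>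
    Real.sq_sqrt (sub_nonneg.2 ((one_le_inv₀ (hpos i)).2 (hle i)))
  have hprod : vCoord Z ^ 2 = ∏ i, (1 + √((a i)⁻¹ - 1) ^ 2) := by
    rw [vCoord_sq hQ ha]
    exact Finset.prod_congr rfl fun i _ => by rw [hsq]; ring
  have hv1 : 1 ≤ vCoord Z := by
    have h : (1 : ℝ) ≤ ∏ i, (1 + √((a i)⁻¹ - 1) ^ 2) :=
      Finset.one_le_prod fun i _ => by nlinarith [sq_nonneg (√((a i)⁻¹ - 1))]
    rw [← hprod] at h
    nlinarith
  have h4 := hessian_lower_bound (η := η) hp hpos (fun i => Real.sqrt_nonneg _) hv0.le hv hprod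
    (le_trans (Finset.card_le_card fun i hi => ?_) ((card_ne_one_le hQ ha).trans hpm.ge))
    (by rw [hpm, Fintype.card_fin]; exact min_le_left _ _)
  · rw [← h2, ← h3] at h4
    have h5 := mul_le_mul_of_nonneg_left h1 (sub_nonneg.2 hv1)
    have h6 : ((vCoord Z - 1) / (p * vCoord Z * (vCoord Z ^ ((2 : ℝ) / p) - 1)) +
        (p + 1) / (p * vCoord Z)) * (vCoord Z * logDiff Z X) ^ 2 =
        vCoord Z * (((vCoord Z - 1) / (p * (vCoord Z ^ ((2 : ℝ) / p) - 1)) + 1 / p) *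
          logDiff Z X ^ 2 + logDiff Z X ^ 2) := by
      have e1 : (vCoord Z - 1) / (p * vCoord Z * (vCoord Z ^ ((2 : ℝ) / p) - 1)) =
          (vCoord Z - 1) / (p * (vCoord Z ^ ((2 : ℝ) / p) - 1)) / vCoord Z := by
        rw [div_div]
        congr 1
        ring
      rw [e1]
      generalize (vCoord Z - 1) / (p * (vCoord Z ^ ((2 : ℝ) / p) - 1)) = r
      field_simp
      ring
    rw [h6, hessForm, mul_assoc, ← mul_add]
    refine mul_le_mul_of_nonneg_left ?_ hv0.le
    linarith
  · simp only [Finset.mem_filter, Finset.mem_univ, true_and, ne_eq] at hi ⊢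
    exact fun h => hi (by rw [h]; simp)

theorem contDiff_vCoord :
    ContDiff ℝ ∞ (fun z : Fin n → Fin m → ℝ => vCoord (Matrix.of z)) := by
  refine ContDiff.sqrt ?_ fun z => (det_one_add_pos (Matrix.of z)).ne'
  simp only [Matrix.det_apply, Matrix.add_apply, Matrix.mul_apply, Matrix.transpose_apply,
    Matrix.of_apply]
  fun_prop

end forms

/-! ### Jordan angles and the eigenvalues of `Wᵀ W` -/

section jordan

variable [NeZero n] {ε : OrthonormalBasis (Fin n ⊕ Fin m) ℝ (Ambient n m)} {P₀ : OrientedPlane n m}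

/-- The eigenvalues of `Wᵀ W`. -/
abbrev cosSq (P₀ P : OrientedPlane n m) : Fin n → ℝ :=
  (Matrix.isHermitian_conjTranspose_mul_self (gramMatrix P₀ P)).eigenvalues

/-- The eigenvalues of `Wᵀ W` in decreasing order. -/
abbrev cosSq₀ (P₀ P : OrientedPlane n m) : Fin (Fintype.card (Fin n)) → ℝ :=
  (Matrix.isHermitian_conjTranspose_mul_self (gramMatrix P₀ P)).eigenvalues₀

/-- The position of an eigenvalue of `Wᵀ W` in the decreasing order. -/
abbrev rankEquiv (n : ℕ) : Fin (Fintype.card (Fin n)) ≃ Fin n :=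
  Fintype.equivOfCardEq (Fintype.card_fin _)

theorem cosSq_rankEquiv (P₀ P : OrientedPlane n m) (k : Fin (Fintype.card (Fin n))) :
    cosSq P₀ P (rankEquiv n k) = cosSq₀ P₀ P k := by
  simp [cosSq, cosSq₀, Matrix.IsHermitian.eigenvalues]

theorem jordanAngle_eq (P₀ P : OrientedPlane n m) (α : Fin (min n m))
    (k : Fin (Fintype.card (Fin n))) (hk : (k : ℕ) = n - min n m + α) :
    jordanAngle P₀ P α = Real.arccos √(cosSq P₀ P (rankEquiv n k)) := by
  rw [cosSq_rankEquiv, jordanAngle]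
  congr 3
  exact Fin.ext hk.symm

/-- If the eigenvalue in position `k` were below `1`, so would be all later ones, giving `n - k >
min n m` eigenvalues different from `1`. -/
theorem cosSq₀_eq_one (hε : P₀ = orientedSpan (fun i => ε (Sum.inl i)) (linearIndependent_inl ε))
    {P : OrientedPlane n m} (hP : P ∈ domainU P₀) (k : Fin (Fintype.card (Fin n)))
    (hk : (k : ℕ) < n - min n m) : cosSq₀ P₀ P k = 1 := by
  obtain ⟨Q, hQ, ha⟩ := exists_diagonalization hε hP
  have hle := (exists_rescaled_components hQ ha).2.1
  by_contra h
  have hlt : cosSq₀ P₀ P k < 1 := lt_of_le_of_ne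
    (by rw [← cosSq_rankEquiv]; exact hle _) h
  have h1 : ((Finset.Ici k).map (rankEquiv n).toEmbedding).card ≤ min n m := by
    refine le_trans (Finset.card_le_card fun i hi => ?_) (card_ne_one_le hQ ha)
    obtain ⟨j, hj, rfl⟩ := Finset.mem_map.1 hi
    refine Finset.mem_filter.2 ⟨Finset.mem_univ _, ?_⟩
    rw [Equiv.coe_toEmbedding]
    change cosSq P₀ P (rankEquiv n j) ≠ 1
    refine ne_of_lt ?_
    rw [cosSq_rankEquiv]
    exact (Matrix.IsHermitian.eigenvalues₀_antitone _ (Finset.mem_Ici.1 hj)).trans_lt hlt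
  rw [Finset.card_map, Fin.card_Ici] at h1
  have h2 := Fintype.card_fin n
  omega

/-- From `θ < π / 2 - θ'` follows `cos θ > sin θ'`, and squaring gives `a > 1 - b`. An index outside
the Jordan range has eigenvalue `1`, where positivity of the other suffices. -/
theorem one_lt_cosSq_add (hε : P₀ = orientedSpan (fun i => ε (Sum.inl i)) (linearIndependent_inl ε))
    {P : OrientedPlane n m} (hP : P ∈ ballJX P₀) {i k : Fin n} (hik : i ≠ k) :
    1 < cosSq P₀ P i + cosSq P₀ P k := by
  obtain ⟨Q, hQ, ha⟩ := exists_diagonalization hε hP.1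
  obtain ⟨hpos, hle, -⟩ := exists_rescaled_components hQ ha
  obtain ⟨i, rfl⟩ := (rankEquiv n).surjective i
  obtain ⟨k, rfl⟩ := (rankEquiv n).surjective k
  have hi2 : (i : ℕ) < n := i.2.trans_eq (Fintype.card_fin n)
  have hk2 : (k : ℕ) < n := k.2.trans_eq (Fintype.card_fin n)
  by_cases hi : (i : ℕ) < n - min n m
  · rw [cosSq_rankEquiv, cosSq₀_eq_one hε hP.1 i hi]
    linarith [hpos (rankEquiv n k)]
  by_cases hk : (k : ℕ) < n - min n m
  · rw [cosSq_rankEquiv _ _ k, cosSq₀_eq_one hε hP.1 k hk]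
    linarith [hpos (rankEquiv n i)]
  have hne : (⟨i - (n - min n m), by omega⟩ : Fin (min n m)) ≠
      ⟨k - (n - min n m), by omega⟩ := by
    intro h
    have h' := Fin.mk.inj h
    exact hik (congrArg _ (Fin.ext (by omega)))
  have h := hP.2 _ _ hne
  rw [jordanAngle_eq P₀ P _ i (by simp only; omega),
    jordanAngle_eq P₀ P _ k (by simp only; omega)] at h
  set a := cosSq P₀ P (rankEquiv n i)
  set b := cosSq P₀ P (rankEquiv n k)
  have ha0 : 0 < a := hpos _
  have hb0 : 0 < b := hpos _
  have ha1 : a ≤ 1 := hle _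
  have hb1 : b ≤ 1 := hle _
  have h1 : Real.cos (Real.pi / 2 - Real.arccos √b) < Real.cos (Real.arccos √a) :=
    Real.cos_lt_cos_of_nonneg_of_le_pi (Real.arccos_nonneg _)
      (by linarith [Real.arccos_nonneg √b, Real.pi_pos]) (by linarith)
  rw [Real.cos_pi_div_two_sub, Real.sin_arccos, Real.sq_sqrt hb0.le,
    Real.cos_arccos (by linarith [Real.sqrt_nonneg a]) (Real.sqrt_le_one.2 ha1)] at h1
  have h2 := (Real.sqrt_lt_sqrt_iff (sub_nonneg.2 hb1)).1 h1
  linarith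

theorem v_eq_prod_sec (hε : P₀ = orientedSpan (fun i => ε (Sum.inl i)) (linearIndependent_inl ε))
    {P : OrientedPlane n m} (hP : P ∈ domainU P₀) :
    v P₀ P = ∏ α, (Real.cos (jordanAngle P₀ P α))⁻¹ := by
  obtain ⟨Q, hQ, ha⟩ := exists_diagonalization hε hP
  obtain ⟨hpos, hle, -⟩ := exists_rescaled_components hQ ha
  have h1 : v P₀ P = ∏ i, (√(cosSq P₀ P i))⁻¹ := by
    have h2 := vCoord_sq hQ ha
    rw [v_eq_vCoord hε hP]
    refine (pow_left_inj₀ (vCoord_pos _).le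
      (Finset.prod_nonneg fun i _ => inv_nonneg.2 (Real.sqrt_nonneg _)) two_ne_zero).1 ?_
    rw [h2, ← Finset.prod_pow]
    refine Finset.prod_congr rfl fun i _ => ?_
    rw [inv_pow, Real.sq_sqrt (hpos i).le]
  rw [h1, ← (rankEquiv n).prod_comp]
  symm
  have hlt : ∀ α : Fin (min n m), n - min n m + α < Fintype.card (Fin n) := fun α => by
    rw [Fintype.card_fin]
    have := α.2
    omega
  refine Finset.prod_of_injOn (fun α : Fin (min n m) =>
    (⟨n - min n m + α, hlt α⟩ : Fin (Fintype.card (Fin n)))) ?_ (fun _ _ => Finset.mem_coe.2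
      (Finset.mem_univ _)) ?_ ?_
  · intro α _ β _ h
    have h' := Fin.mk.inj h
    exact Fin.ext (by omega)
  · intro k _ hk
    have hk2 : (k : ℕ) < n := k.2.trans_eq (Fintype.card_fin n)
    have h3 : (k : ℕ) < n - min n m := by
      by_contra h
      refine hk ⟨⟨k - (n - min n m), by omega⟩, Finset.mem_coe.2 (Finset.mem_univ _), ?_⟩
      exact Fin.ext (by simp only; omega)
    rw [cosSq_rankEquiv, cosSq₀_eq_one hε hP k h3, Real.sqrt_one, inv_one]
  · intro α _
    rw [jordanAngle_eq P₀ P α ⟨n - min n m + α, hlt α⟩ rfl, Real.cos_arccos]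
    · linarith [Real.sqrt_nonneg (cosSq P₀ P (rankEquiv n ⟨n - min n m + α, hlt α⟩))]
    · exact Real.sqrt_le_one.2 (hle _)

end jordan

/-! ### Transfer to the Grassmannian and convexity along geodesics -/

section main

variable [NeZero n] {ε : OrthonormalBasis (Fin n ⊕ Fin m) ℝ (Ambient n m)} {P₀ : OrientedPlane n m}

theorem hess_v (hε : P₀ = orientedSpan (fun i => ε (Sum.inl i)) (linearIndependent_inl ε))
    (P : OrientedPlane n m) (X Y : Matrix (Fin n) (Fin m) ℝ) :
    hess ε (v P₀) P X Y = hessForm (coord ε P) X Y := by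
  have h : (fun Z => v P₀ (graphPlane ε Z)) = vCoord := funext fun Z => v_graphPlane hε Z
  simp only [hess, h, hessComponent_vCoord]
  exact sum_mul_bilinear (hessBilin (coord ε P)) X Y

theorem differential_v
    (hε : P₀ = orientedSpan (fun i => ε (Sum.inl i)) (linearIndependent_inl ε))
    (P : OrientedPlane n m) (X : Matrix (Fin n) (Fin m) ℝ) :
    differential ε (v P₀) P X = vCoord (coord ε P) * logDiff (coord ε P) X := by
  have h : (fun Z => v P₀ (graphPlane ε Z)) = vCoord := funext fun Z => v_graphPlane hε Z
  simp only [differential, h, partialDeriv_vCoord]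
  exact sum_mul_linear (diffLinear (coord ε P)) X

theorem hessForm_pos_of_mem_ballJX
    (hε : P₀ = orientedSpan (fun i => ε (Sum.inl i)) (linearIndependent_inl ε))
    {P : OrientedPlane n m} (hP : P ∈ ballJX P₀) {X : Matrix (Fin n) (Fin m) ℝ} (hX : X ≠ 0) :
    0 < hessForm (coord ε P) X X := by
  obtain ⟨Q, hQ, ha⟩ := exists_diagonalization hε hP.1
  exact hessForm_pos hQ ha (fun i k => one_lt_cosSq_add hε hP) hX

theorem hessForm_nonneg_of_mem_ballJX
    (hε : P₀ = orientedSpan (fun i => ε (Sum.inl i)) (linearIndependent_inl ε))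
    {P : OrientedPlane n m} (hP : P ∈ ballJX P₀) (X : Matrix (Fin n) (Fin m) ℝ) :
    0 ≤ hessForm (coord ε P) X X := by
  by_cases hX : X = 0
  · simp [hX, hessForm, metric_eq, logDiff]
  · exact (hessForm_pos_of_mem_ballJX hε hP hX).le

theorem geodesicallyConvexOn_v
    (hε : P₀ = orientedSpan (fun i => ε (Sum.inl i)) (linearIndependent_inl ε)) :
    GeodesicallyConvexOn ε P₀ (v P₀) (ballJX P₀) := by
  intro s γ hs hconv ⟨hU, hsmooth, hgeo⟩ hJX
  set z : ℝ → Matrix (Fin n) (Fin m) ℝ := fun t => coord ε (γ t) with hz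
  let z' : ℝ → Matrix (Fin n) (Fin m) ℝ := fun t => Matrix.of fun i α => deriv (fun τ => z τ i α) t
  let z'' : ℝ → Matrix (Fin n) (Fin m) ℝ := fun t => Matrix.of fun i α =>
    deriv (deriv fun τ => z τ i α) t
  have hz1 : ∀ t ∈ s, HasMatDerivAt z (z' t) t := fun t ht i α =>
    (((hsmooth i α).differentiableOn (by norm_num)).differentiableAt (hs.mem_nhds ht)).hasDerivAt
  have hz2 : ∀ t ∈ s, HasMatDerivAt z' (z'' t) t := fun t ht i α => by
    have h1 : ContDiffOn ℝ 1 (deriv fun τ => z τ i α) s :=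
      (hsmooth i α).deriv_of_isOpen hs (by norm_num)
    exact ((h1.differentiableOn (by norm_num)).differentiableAt (hs.mem_nhds ht)).hasDerivAt
  have hgeo' : ∀ t ∈ s, z'' t + connection (z t) (z' t) (z' t) = 0 := by
    intro t ht
    ext i α
    have h1 := hgeo t ht (i, α)
    have h2 := congrFun (congrFun
      (sum_mul_bilinear (connectionBilin (z t)) (z' t) (z' t)) i) α
    simp only [Matrix.sum_apply, Matrix.smul_apply] at h2
    rw [Matrix.add_apply, Matrix.zero_apply, ← h1]
    refine congrArg _ (h2.symm.trans ?_)
    refine Finset.sum_congr rfl fun a _ => Finset.sum_congr rfl fun b _ => ?_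
    rw [christoffel_eq, smul_eq_mul, mul_comm, ← mul_assoc]
    rfl
  have hd1 : ∀ t ∈ s, HasDerivAt (fun t => vCoord (z t)) (vCoord (z t) * logDiff (z t) (z' t)) t :=
    fun t ht => (hz1 t ht).vCoord
  -- The geodesic equation removes the first-order term, leaving the Hessian on the velocity.
  have hd2 : ∀ t ∈ s, HasDerivAt (fun t => vCoord (z t) * logDiff (z t) (z' t))
      (hessForm (z t) (z' t) (z' t)) t := fun t ht => by
    refine ((hz1 t ht).logDiff (hz2 t ht)).congr_deriv ?_
    rw [hgeo' t ht]
    simp [logDiff]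
  have hc : ConvexOn ℝ s (fun t => vCoord (z t)) := by
    refine convexOn_of_hasDerivWithinAt2_nonneg hconv
      (f' := fun t => vCoord (z t) * logDiff (z t) (z' t))
      (f'' := fun t => hessForm (z t) (z' t) (z' t))
      (fun t ht => (hd1 t ht).continuousAt.continuousWithinAt) ?_ ?_ ?_
    · exact fun t ht => (hd1 t (interior_subset ht)).hasDerivWithinAt
    · exact fun t ht => (hd2 t (interior_subset ht)).hasDerivWithinAt
    · exact fun t ht => hessForm_nonneg_of_mem_ballJX hε (hJX t (interior_subset ht)) _
  exact hc.congr fun t ht => (v_eq_vCoord hε (hU t ht)).symm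

end main

end Grass

end

open scoped ContDiff in
theorem mainTheorem4 (n m : ℕ) [NeZero n] [NeZero m] (P₀ : Grass.OrientedPlane n m)
    (ε : OrthonormalBasis (Fin n ⊕ Fin m) ℝ (Grass.Ambient n m))
    (hε : P₀ = Grass.orientedSpan (fun i => ε (Sum.inl i)) (Grass.linearIndependent_inl ε)) :
    -- `v` is smooth in the coordinates of `U`
    ContDiff ℝ ∞ (fun z : Fin n → Fin m → ℝ =>
      Grass.v P₀ (Grass.graphPlane ε (Matrix.of z))) ∧
    -- `v` is the product of the secants of the Jordan angles
    (∀ P ∈ Grass.domainU P₀, Grass.v P₀ P = ∏ α, (Real.cos (Grass.jordanAngle P₀ P α))⁻¹) ∧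
    -- `v` is convex on `B_{JX}(P₀)`, with positive definite Hessian
    Grass.GeodesicallyConvexOn ε P₀ (Grass.v P₀) (Grass.ballJX P₀) ∧
    (∀ P ∈ Grass.ballJX P₀, ∀ X : Matrix (Fin n) (Fin m) ℝ, X ≠ 0 →
      0 < Grass.hess ε (Grass.v P₀) P X X) ∧
    -- the lower bound of the Hessian on `{v ≤ 2}`
    (∀ P ∈ Grass.domainU P₀, Grass.v P₀ P ≤ 2 → ∀ p : ℕ, p = min n m →
      ∀ X : Matrix (Fin n) (Fin m) ℝ,
        Grass.v P₀ P * (2 - Grass.v P₀ P) * Grass.metricAt ε P X X +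
          ((Grass.v P₀ P - 1) / (p * Grass.v P₀ P * (Grass.v P₀ P ^ ((2 : ℝ) / p) - 1)) +
              (p + 1) / (p * Grass.v P₀ P)) * Grass.differential ε (Grass.v P₀) P X ^ 2 ≤
        Grass.hess ε (Grass.v P₀) P X X) := by
  refine ⟨?_, fun P hP => Grass.v_eq_prod_sec hε hP, Grass.geodesicallyConvexOn_v hε,
    fun P hP X hX => ?_, fun P hP hv p hp X => ?_⟩
  · simp only [Grass.v_graphPlane hε]
    exact Grass.contDiff_vCoord
  · rw [Grass.hess_v hε]
    exact Grass.hessForm_pos_of_mem_ballJX hε hP hX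
  · obtain ⟨Q, hQ, ha⟩ := Grass.exists_diagonalization hε hP
    have hp0 : p ≠ 0 := by
      have := NeZero.ne n
      have := NeZero.ne m
      omega
    rw [Grass.hess_v hε, Grass.differential_v hε, Grass.v_eq_vCoord hε hP, Grass.metricAt]
    rw [Grass.v_eq_vCoord hε hP] at hv
    exact Grass.le_hessForm hQ ha hv hp0 hp X
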